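/- Let $n\ge 0$ be an integer, let $M\subset\mathbb R^{2n}$ be an open set containing the origin, and write its points as $z=(q,p)=(q_1,\dots,q_n,p_1,\dots,p_n)$, with Euclidean norm $\|z\|$. Let $\omega\in\mathbb R^n$ be non-resonant, i.e. $\sum_{j=1}^n k_j\omega_j\neq 0$ for all $k\in\mathbb Z^n\setminus\{0\}$. Put $I_j(q,p)=\tfrac12(p_j^2+q_j^2)$ and let $$H=H_0+P,\qquad H_0=\sum_{j=1}^n\omega_j I_j,$$ where $P\in C^\infty(M,\mathbb R)$ has a zero of order $3$ at the origin, i.e. $P(z)=O(\|z\|^3)$ as $z\to 0$. Consider in $M$ the Hamiltonian system $\dot q_j=\partial H/\partial p_j$, $\dot p_j=-\partial H/\partial q_j$ ($j=1,\dots,n$). There is a constant $K>0$, depending only on $H$ and $M$, such that for every integer $r\ge 3$ there exist $\varepsilon_0>0$ and $C>0$ with the following property. If $\|(q_0,p_0)\|=\varepsilon<\varepsilon_0$, then the (unique) solution $(q(t),p(t))$ of the system with value $(q_0,p_0)\in M$ at $t=0$ exists in $M$ for all $|t|\le C/\varepsilon^{r-1}$ and satisfies $$\|(q(t),p(t))\|\le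 2\varepsilon\qquad\text{for } |t|\le \frac{C}{\varepsilon^{r-1}}.$$ Furthermore, for each $j=1,\dots,n$, $$|I_j(q(t),p(t))-I_j(q_0,p_0)|\le K\varepsilon^3\qquad\text{for every } t \text{ in the interval of existence with } |t|\le \frac{C}{\varepsilon^{r-2}}.$$ (For $\varepsilon=0$ the time bounds are void: the statement then holds for all $t$.) -/

import Mathlib

open Set Filter Topology Asymptotics

noncomputable section

/-- The space `ℝ^{2n}` of points `z = (q, p)` with its Euclidean norm: `q_j = z (Sum.inl j)` and
`p_j = z (Sum.inr j)`. -/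
abbrev PhaseSpace (n : ℕ) : Type := EuclideanSpace ℝ (Fin n ⊕ Fin n)

/-- The partial derivative `∂H/∂q_j`. -/
def partialQ {n : ℕ} (H : PhaseSpace n → ℝ) (j : Fin n) (z : PhaseSpace n) : ℝ :=
  fderiv ℝ H z (EuclideanSpace.single (Sum.inl j) 1)

/-- The partial derivative `∂H/∂p_j`. -/
def partialP {n : ℕ} (H : PhaseSpace n → ℝ) (j : Fin n) (z : PhaseSpace n) : ℝ :=
  fderiv ℝ H z (EuclideanSpace.single (Sum.inr j) 1)

/-- The Hamiltonian vector field `X_H = (∂H/∂p, -∂H/∂q)`. -/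
def hamiltonianVectorField {n : ℕ} (H : PhaseSpace n → ℝ) (z : PhaseSpace n) : PhaseSpace n :=
  WithLp.toLp 2 (Sum.elim (fun j => partialP H j z) (fun j => -partialQ H j z))

/-- `γ` is a solution on the time set `s` of the Hamiltonian system of `H`, in the phase
space `M`. -/
def IsHamiltonianSolutionOn {n : ℕ} (M : Set (PhaseSpace n)) (H : PhaseSpace n → ℝ)
    (γ : ℝ → PhaseSpace n) (s : Set ℝ) : Prop :=
  MapsTo γ s M ∧ IsIntegralCurveOn γ (fun _ => hamiltonianVectorField H) s

/-- The `j`-th action `I_j = (p_j² + q_j²) / 2`. -/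
def action {n : ℕ} (j : Fin n) (z : PhaseSpace n) : ℝ :=
  (z (Sum.inr j) ^ 2 + z (Sum.inl j) ^ 2) / 2

/-- The harmonic oscillator `H₀ = ∑ ω_j I_j`. -/
def harmonicOscillator {n : ℕ} (ω : Fin n → ℝ) (z : PhaseSpace n) : ℝ :=
  ∑ j, ω j * action j z

/-- The frequency vector `ω` is non-resonant. -/
def NonResonant {n : ℕ} (ω : Fin n → ℝ) : Prop :=
  ∀ k : Fin n → ℤ, k ≠ 0 → ∑ j, (k j : ℝ) * ω j ≠ 0

end

/-!
A polynomial Hamiltonian that agrees with `H` to high order at the origin has approximate integrals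
`Φ_j` starting with `I_j`. In the nilpotent Lie algebra of the Hamiltonians of order at least `2`
modulo those of high order, non-resonance makes the homological equation solvable, so an
automorphism `exp (ad χ_k) ∘ ⋯ ∘ exp (ad χ_1)` brings the Hamiltonian to a normal form that commutes
with every `I_j`; pulling `I_j` back by this automorphism gives `Φ_j`. Along the flow of `H` the
function `Φ_j` drifts at a rate `O(‖z‖ ^ N)` for an arbitrarily large `N`. Since
`‖z‖ ^ 2 = 2 ∑ I_j`, the drift and the distance of `Φ_j` from `I_j` keep a solution in the ball of
radius `2ε` for a time `C / ε ^ (r - 1)`.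

The constant `K` does not depend on `r` because no cubic monomial is resonant: the part of `Φ_j` of
order `3`, which dominates `Φ_j - I_j`, is determined by the cubic part of `H`.
-/

noncomputable section

namespace BirkhoffNormalForm

open MvPolynomial

/-! ### Polynomial Poisson brackets -/

section OrderIdeal

variable {σ R : Type*} [CommRing R]

/-- The ideal of the polynomials that vanish at the origin to order at least `m`. -/
abbrev ordIdeal (σ R : Type*) [CommRing R] (m : ℕ) : Ideal (MvPolynomial σ R) :=
  idealOfVars σ R ^ m

theorem mem_ordIdeal_iff_coeff {m : ℕ} {p : MvPolynomial σ R} :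
    p ∈ ordIdeal σ R m ↔ ∀ α : σ →₀ ℕ, α.degree < m → coeff α p = 0 :=
  mem_pow_idealOfVars_iff' m p

theorem ordIdeal_antitone : Antitone (ordIdeal σ R) :=
  fun _ _ h => Ideal.pow_le_pow_right h

theorem X_mem_ordIdeal_one (i : σ) : (X i : MvPolynomial σ R) ∈ ordIdeal σ R 1 := by
  rw [ordIdeal, pow_one]
  exact Ideal.subset_span ⟨i, rfl⟩

theorem mul_mem_ordIdeal_add {a b : ℕ} {p q : MvPolynomial σ R} (hp : p ∈ ordIdeal σ R a)
    (hq : q ∈ ordIdeal σ R b) : p * q ∈ ordIdeal σ R (a + b) := by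
  rw [ordIdeal, pow_add]
  exact Ideal.mul_mem_mul hp hq

theorem pderiv_mem_ordIdeal {m : ℕ} {p : MvPolynomial σ R} (i : σ) (hp : p ∈ ordIdeal σ R m) :
    pderiv i p ∈ ordIdeal σ R (m - 1) := by
  rw [mem_ordIdeal_iff_coeff] at hp ⊢
  intro α hα
  rw [coeff_pderiv, hp, zero_mul]
  rw [map_add, Finsupp.degree_single]
  omega

theorem pderiv_pderiv_comm (i j : σ) (p : MvPolynomial σ R) :
    pderiv i (pderiv j p) = pderiv j (pderiv i p) := by
  classical
  have h : ⁅pderiv (R := R) i, pderiv (R := R) j⁆ = 0 := derivation_ext fun k => by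
    rw [Derivation.commutator_apply]
    simp [pderiv_X, Pi.single_apply, apply_ite]
  rw [← sub_eq_zero, ← Derivation.commutator_apply, h, Derivation.coe_zero, Pi.zero_apply]

theorem coeff_X_mul_pderiv (i : σ) (p : MvPolynomial σ R) (α : σ →₀ ℕ) :
    coeff α (X i * pderiv i p) = α i * coeff α p := by
  classical
  induction p using MvPolynomial.induction_on' with
  | monomial β c =>
    rw [X_mul_pderiv_monomial, coeff_smul, coeff_monomial]
    split_ifs with h <;> simp [h]
  | add p q hp hq => rw [map_add, mul_add, coeff_add, coeff_add, hp, hq, mul_add]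

end OrderIdeal

section Poisson

variable {ι R : Type*} [CommRing R]

variable (R) in
/-- The polynomial `ξ_j η_j`, twice the action `I_j` when `ξ_j = q_j + i p_j` and
`η_j = q_j - i p_j`. -/
def actionPoly (j : ι) : MvPolynomial (ι ⊕ ι) R := X (Sum.inl j) * X (Sum.inr j)

theorem actionPoly_mem_ordIdeal (j : ι) : actionPoly R j ∈ ordIdeal (ι ⊕ ι) R 2 :=
  mul_mem_ordIdeal_add (X_mem_ordIdeal_one _) (X_mem_ordIdeal_one _)

variable [Fintype ι]

/-- The Hamiltonian derivation `{f, ·}` of the polynomials in canonically conjugate variables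
`ξ_j = X (Sum.inl j)` and `η_j = X (Sum.inr j)`, with the sign convention `{ξ_j, η_j} = 1`. -/
def poisson (f : MvPolynomial (ι ⊕ ι) R) :
    Derivation R (MvPolynomial (ι ⊕ ι) R) (MvPolynomial (ι ⊕ ι) R) :=
  ∑ j, (pderiv (Sum.inl j) f • pderiv (Sum.inr j) - pderiv (Sum.inr j) f • pderiv (Sum.inl j))

theorem poisson_apply (f g : MvPolynomial (ι ⊕ ι) R) :
    poisson f g = ∑ j, (pderiv (Sum.inl j) f * pderiv (Sum.inr j) g -
      pderiv (Sum.inr j) f * pderiv (Sum.inl j) g) := by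
  rw [poisson, ← Derivation.coeFnAddMonoidHom_apply, map_sum, Finset.sum_apply]
  rfl

theorem poisson_add (f f' : MvPolynomial (ι ⊕ ι) R) :
    poisson (f + f') = poisson f + poisson f' := by
  simp only [poisson, map_add, add_smul, add_sub_add_comm, Finset.sum_add_distrib]

theorem poisson_self (f : MvPolynomial (ι ⊕ ι) R) : poisson f f = 0 := by
  rw [poisson_apply]
  exact Finset.sum_eq_zero fun j _ => by ring

theorem poisson_swap (f g : MvPolynomial (ι ⊕ ι) R) : poisson f g = -poisson g f := by
  rw [poisson_apply, poisson_apply, ← Finset.sum_neg_distrib]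
  exact Finset.sum_congr rfl fun j _ => by ring

theorem poisson_X_inl (f : MvPolynomial (ι ⊕ ι) R) (j : ι) :
    poisson f (X (Sum.inl j)) = -pderiv (Sum.inr j) f := by
  classical
  simp [poisson_apply, pderiv_X, Pi.single_apply]

theorem poisson_X_inr (f : MvPolynomial (ι ⊕ ι) R) (j : ι) :
    poisson f (X (Sum.inr j)) = pderiv (Sum.inl j) f := by
  classical
  simp [poisson_apply, pderiv_X, Pi.single_apply]

theorem pderiv_poisson (i : ι ⊕ ι) (f g : MvPolynomial (ι ⊕ ι) R) :
    pderiv i (poisson f g) = poisson (pderiv i f) g + poisson f (pderiv i g) := by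
  simp only [poisson_apply, map_sum, map_sub, pderiv_mul, ← Finset.sum_add_distrib,
    pderiv_pderiv_comm i]
  exact Finset.sum_congr rfl fun j _ => by ring

/-- It is enough to compare the two derivations on the variables, where the Jacobi identity
becomes `pderiv_poisson`. -/
theorem poisson_poisson (f g : MvPolynomial (ι ⊕ ι) R) :
    poisson (poisson f g) = ⁅poisson f, poisson g⁆ := by
  refine derivation_ext fun i => ?_
  rw [Derivation.commutator_apply]
  rcases i with j | j
  · rw [poisson_X_inl, poisson_X_inl, poisson_X_inl, pderiv_poisson, map_neg, map_neg,
      poisson_swap _ g]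
    ring
  · rw [poisson_X_inr, poisson_X_inr, poisson_X_inr, pderiv_poisson, poisson_swap _ g]
    ring

theorem poisson_mem_ordIdeal {a b c : ℕ} {f g : MvPolynomial (ι ⊕ ι) R}
    (hf : f ∈ ordIdeal (ι ⊕ ι) R a) (hg : g ∈ ordIdeal (ι ⊕ ι) R b) (hc : c + 2 ≤ a + b) :
    poisson f g ∈ ordIdeal (ι ⊕ ι) R c := by
  have pderiv_mul_pderiv_mem (i k : ι ⊕ ι) :
      pderiv i f * pderiv k g ∈ ordIdeal (ι ⊕ ι) R c :=
    ordIdeal_antitone (show c ≤ (a - 1) + (b - 1) by omega)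
      (mul_mem_ordIdeal_add (pderiv_mem_ordIdeal i hf) (pderiv_mem_ordIdeal k hg))
  rw [poisson_apply]
  exact sum_mem fun j _ => sub_mem (pderiv_mul_pderiv_mem _ _) (pderiv_mul_pderiv_mem _ _)

theorem coeff_poisson_actionPoly (f : MvPolynomial (ι ⊕ ι) R) (j : ι) (α : ι ⊕ ι →₀ ℕ) :
    coeff α (poisson f (actionPoly R j)) =
      ((α (Sum.inl j) : R) - α (Sum.inr j)) * coeff α f := by
  have h : poisson f (actionPoly R j) =
      X (Sum.inl j) * pderiv (Sum.inl j) f - X (Sum.inr j) * pderiv (Sum.inr j) f := by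
    rw [actionPoly, Derivation.leibniz, poisson_X_inl, poisson_X_inr, smul_eq_mul, smul_eq_mul]
    ring
  rw [h, coeff_sub, coeff_X_mul_pderiv, coeff_X_mul_pderiv, sub_mul]

end Poisson

/-! ### Normal forms in filtered Lie algebras -/

section LieFiltration

variable {L : Type*} [LieRing L] [LieAlgebra ℚ L]

/-- `F` is a decreasing filtration of the Lie algebra `L` by subspaces that add up their degrees
under the bracket. -/
structure IsLieFiltration (F : ℕ → Submodule ℚ L) : Prop where
  antitone : Antitone F
  zero_eq_top : F 0 = ⊤
  lie_mem {a b : ℕ} {x y : L} : x ∈ F a → y ∈ F b → ⁅x, y⁆ ∈ F (a + b)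

/-- The homological equation `R + ⁅χ, h₀⁆ = ζ` can be solved in every term of the filtration `F`,
with a right-hand side `ζ` that commutes with the family `s`. -/
def HomologicallySolvable (F : ℕ → Submodule ℚ L) {ι : Type*} (s : ι → L)
    (h₀ : L) : Prop :=
  ∀ m, ∀ R ∈ F m, ∃ χ ∈ F m, ∀ j, ⁅s j, R + ⁅χ, h₀⁆⁆ = 0

namespace IsLieFiltration

variable {F : ℕ → Submodule ℚ L} {ι : Type*} {s : ι → L} {h h₀ : L}

theorem mem_zero (hF : IsLieFiltration F) (x : L) : x ∈ F 0 :=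
  hF.zero_eq_top ▸ Submodule.mem_top

theorem ad_pow_mem (hF : IsLieFiltration F) {a c : ℕ} {χ x : L} (hχ : χ ∈ F c) (hx : x ∈ F a)
    (k : ℕ) : (LieAlgebra.ad ℚ L χ ^ k) x ∈ F (k * c + a) := by
  induction k with
  | zero => simpa using hx
  | succ k ih =>
    rw [pow_succ', Module.End.mul_apply, LieAlgebra.ad_apply, add_one_mul, add_right_comm,
      add_comm]
    exact hF.lie_mem hχ ih

theorem ad_pow_eq_zero (hF : IsLieFiltration F) {N c : ℕ} (hN : F N = ⊥) {χ : L} (hχ : χ ∈ F c)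
    (hc : 0 < c) {k : ℕ} (hk : N ≤ k) : LieAlgebra.ad ℚ L χ ^ k = 0 :=
  LinearMap.ext fun x =>
    (Submodule.mem_bot ℚ).mp <| hN ▸
      hF.antitone (by nlinarith) (hF.ad_pow_mem hχ (hF.mem_zero x) k)

theorem exists_equiv_exp (hF : IsLieFiltration F) {N c : ℕ} (hN : F N = ⊥) {χ : L}
    (hχ : χ ∈ F c) (hc : 0 < c) :
    ∃ E : L ≃ₗ⁅ℚ⁆ L, ∀ a, ∀ x ∈ F a,
      E x - x ∈ F (c + a) ∧ E x - (x + ⁅χ, x⁆) ∈ F (2 * c + a) := by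
  have pow_eq_zero : (LieDerivation.ad ℚ L χ).toLinearMap ^ (N + 2) = 0 := by
    rw [LieDerivation.coe_ad_apply_eq_ad_apply]
    exact hF.ad_pow_eq_zero hN hχ hc (by omega)
  have nilpotent : IsNilpotent (LieDerivation.ad ℚ L χ).toLinearMap := ⟨_, pow_eq_zero⟩
  refine ⟨(LieDerivation.ad ℚ L χ).exp nilpotent, fun a x hx => ?_⟩
  have remainder_mem : ∑ i ∈ Finset.range N, ((i + 2).factorial : ℚ)⁻¹ •
      (LieAlgebra.ad ℚ L χ ^ (i + 2)) x ∈ F (2 * c + a) :=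
    sum_mem fun i _ => Submodule.smul_mem _ _
      (hF.antitone (by nlinarith [Nat.zero_le (i * c)]) (hF.ad_pow_mem hχ hx (i + 2)))
  have exp_sub_mem : (LieDerivation.ad ℚ L χ).exp nilpotent x - (x + ⁅χ, x⁆) ∈
      F (2 * c + a) := by
    convert remainder_mem using 1
    rw [LieDerivation.exp_map_apply, IsNilpotent.exp_eq_sum pow_eq_zero,
      LieDerivation.coe_ad_apply_eq_ad_apply, Finset.sum_range_succ', Finset.sum_range_succ']
    simp only [zero_add, Nat.factorial_one, Nat.cast_one, inv_one, pow_one, one_smul,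
      Nat.factorial_zero, pow_zero, LinearMap.add_apply, LinearMap.coe_sum, LinearMap.coe_smul,
      Finset.sum_apply, Pi.smul_apply, LieAlgebra.ad_apply, Module.End.one_apply]
    abel
  refine ⟨?_, exp_sub_mem⟩
  rw [← sub_add_sub_cancel _ (x + ⁅χ, x⁆) x, add_sub_cancel_left]
  exact add_mem (hF.antitone (by omega) exp_sub_mem) (hF.lie_mem hχ hx)

/-- One step of the normal form algorithm: conjugating by `exp (ad χ)` replaces the part `R` of
order `m` by `R + ⁅χ, h₀⁆`, up to higher order. -/
theorem exists_normalForm (hF : IsLieFiltration F) {N : ℕ} (hN : F N = ⊥) (hh : h - h₀ ∈ F 1)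
    (hs : ∀ j, ⁅s j, h₀⁆ = 0) (hom : HomologicallySolvable F s h₀) (k : ℕ) :
    ∃ (E : L ≃ₗ⁅ℚ⁆ L) (Z : L), (∀ x, E x - x ∈ F 1) ∧ (∀ j, ⁅s j, Z⁆ = 0) ∧
      Z - h₀ ∈ F 1 ∧ E h - Z ∈ F (k + 1) := by
  induction k with
  | zero => exact ⟨.refl, h₀, by simp, hs, by simp, hh⟩
  | succ k ih =>
    obtain ⟨E, Z, hE, hZ, hZ₀, hEh⟩ := ih
    obtain ⟨χ, hχ, hsζ⟩ := hom _ _ hEh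
    obtain ⟨Ex, hEx⟩ := hF.exists_equiv_exp hN hχ k.succ_pos
    set R := E h - Z with hR
    refine ⟨E.trans Ex, Z + (R + ⁅χ, h₀⁆), fun x => ?_, fun j => ?_, ?_, ?_⟩
    · rw [LieEquiv.trans_apply, ← sub_add_sub_cancel _ (E x)]
      exact add_mem (hF.antitone (by omega) (hEx 0 _ (hF.mem_zero _)).1) (hE x)
    · rw [lie_add, hZ, hsζ, zero_add]
    · rw [add_sub_right_comm]
      exact add_mem hZ₀ (hF.antitone (by omega)
        (add_mem hEh (hF.lie_mem (b := 0) hχ (hF.mem_zero h₀))))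
    · have split : E.trans Ex h - (Z + (R + ⁅χ, h₀⁆)) =
          (Ex Z - (Z + ⁅χ, Z⁆)) + (Ex R - R) + ⁅χ, Z - h₀⁆ := by
        rw [LieEquiv.trans_apply, lie_sub, ← add_sub_cancel Z (E h), ← hR, map_add]
        abel
      rw [split]
      exact add_mem (add_mem (hF.antitone (by omega) (hEx 0 Z (hF.mem_zero Z)).2)
        (hF.antitone (by omega) (hEx _ R hEh).1)) (hF.antitone (by omega) (hF.lie_mem hχ hZ₀))

theorem exists_lie_eq_zero (hF : IsLieFiltration F) {N : ℕ} (hN : F N = ⊥) (hh : h - h₀ ∈ F 1)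
    (hs : ∀ j, ⁅s j, h₀⁆ = 0) (hom : HomologicallySolvable F s h₀) (j : ι) :
    ∃ Φ : L, Φ - s j ∈ F 1 ∧ ⁅Φ, h⁆ = 0 := by
  obtain ⟨E, Z, hE, hZ, -, hEh⟩ := hF.exists_normalForm hN hh hs hom N
  have hEZ : E h = Z := by
    rw [← sub_eq_zero, ← Submodule.mem_bot ℚ, ← hN]
    exact hF.antitone N.le_succ hEh
  refine ⟨E.symm (s j), ?_, E.injective ?_⟩
  · rw [← neg_mem_iff, neg_sub]
    simpa using hE (E.symm (s j))
  · calc E ⁅E.symm (s j), h⁆ = ⁅s j, Z⁆ := by rw [LieEquiv.map_lie, E.apply_symm_apply, hEZ]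
      _ = E 0 := (hZ j).trans (map_zero E.toLieHom).symm

/-- The term of index `N` of a filtration, as an ideal. -/
def ideal (hF : IsLieFiltration F) (N : ℕ) : LieIdeal ℚ L where
  __ := F N
  lie_mem {x _} hy := hF.antitone (Nat.le_add_left N 0) (hF.lie_mem (hF.mem_zero x) hy)

theorem map_quotient (hF : IsLieFiltration F) (I : LieIdeal ℚ L) :
    IsLieFiltration fun m => (F m).map (LieSubmodule.Quotient.mk' I : L →ₗ[ℚ] L ⧸ I) where
  antitone _ _ h := Submodule.map_mono (hF.antitone h)
  zero_eq_top := by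
    rw [hF.zero_eq_top, Submodule.map_top]
    exact LinearMap.range_eq_top.mpr (LieSubmodule.Quotient.surjective_mk' I)
  lie_mem := by
    rintro a b _ _ ⟨x, hx, rfl⟩ ⟨y, hy, rfl⟩
    exact ⟨⁅x, y⁆, hF.lie_mem hx hy, rfl⟩

theorem exists_lie_mem (hF : IsLieFiltration F) (N : ℕ) (hh : h - h₀ ∈ F 1)
    (hs : ∀ j, ⁅s j, h₀⁆ = 0) (hom : HomologicallySolvable F s h₀) (j : ι) :
    ∃ Φ : L, Φ - s j ∈ F 1 ∧ ⁅Φ, h⁆ ∈ F N := by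
  set I := hF.ideal N
  let π : L →ₗ[ℚ] L ⧸ I := LieSubmodule.Quotient.mk' I
  have π_lie (x y : L) : π ⁅x, y⁆ = ⁅π x, π y⁆ := rfl
  have map_eq_bot : (F N).map π = ⊥ :=
    LinearMap.le_ker_iff_map.mp fun _ =>
      (LieSubmodule.Quotient.mk_eq_zero (N := I)).mpr
  have hom_quotient : HomologicallySolvable (fun m => (F m).map π) (fun j => π (s j)) (π h₀) := by
    rintro m _ ⟨R, hR, rfl⟩
    obtain ⟨χ, hχ, hζ⟩ := hom m R hR
    refine ⟨π χ, Submodule.mem_map_of_mem hχ, fun j => ?_⟩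
    rw [← π_lie, ← map_add, ← π_lie, hζ, map_zero]
  obtain ⟨Ψ, ⟨x, hx, hxΨ⟩, hΨh⟩ := (hF.map_quotient I).exists_lie_eq_zero map_eq_bot
    (map_sub π h h₀ ▸ Submodule.mem_map_of_mem hh)
    (fun j => by rw [← π_lie, hs, map_zero]) hom_quotient j
  have π_add : π (x + s j) = Ψ := by rw [map_add, show π x = _ from hxΨ, sub_add_cancel]
  refine ⟨x + s j, by rwa [add_sub_cancel_right],
    (LieSubmodule.Quotient.mk_eq_zero (N := I)).mp ?_⟩
  rw [← hΨh, ← π_add]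
  rfl

end IsLieFiltration

end LieFiltration

/-! ### Approximate integrals of a non-resonant oscillator -/

section HamiltonianPoly

variable {ι R : Type*} [CommRing R]

/-- The polynomials of order at least `2`, as a Lie algebra under the Poisson bracket: the bracket
lowers the order by `2`, so this is where it is compatible with the filtration by the order. -/
abbrev HamiltonianPoly (ι R : Type*) [CommRing R] : Type _ := ordIdeal (ι ⊕ ι) R 2

/-- The filtration of the Lie algebra `HamiltonianPoly ι R` by the order, shifted so that it is
additive under the bracket. -/
def orderFiltration (ι R : Type*) [CommRing R] [Algebra ℚ R] (m : ℕ) :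
    Submodule ℚ (HamiltonianPoly ι R) :=
  ((ordIdeal (ι ⊕ ι) R (m + 2)).restrictScalars ℚ).comap
    ((ordIdeal (ι ⊕ ι) R 2).subtype.restrictScalars ℚ)

theorem mem_orderFiltration [Algebra ℚ R] {m : ℕ} {f : HamiltonianPoly ι R} :
    f ∈ orderFiltration ι R m ↔ f.1 ∈ ordIdeal (ι ⊕ ι) R (m + 2) :=
  Iff.rfl

variable [Fintype ι]

instance : LieRing (HamiltonianPoly ι R) where
  bracket f g := ⟨poisson f.1 g.1, poisson_mem_ordIdeal f.2 g.2 le_rfl⟩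
  add_lie f f' g := Subtype.ext (DFunLike.congr_fun (poisson_add f.1 f'.1) g.1)
  lie_add f g g' := Subtype.ext (map_add _ g.1 g'.1)
  lie_self f := Subtype.ext (poisson_self f.1)
  leibniz_lie f g h := Subtype.ext <| by
    change poisson f.1 (poisson g.1 h.1) =
      poisson (poisson f.1 g.1) h.1 + poisson g.1 (poisson f.1 h.1)
    rw [poisson_poisson, Derivation.commutator_apply, sub_add_cancel]

theorem HamiltonianPoly.coe_lie (f g : HamiltonianPoly ι R) : (⁅f, g⁆).1 = poisson f.1 g.1 :=
  rfl

theorem HamiltonianPoly.lie_eq_zero {f g : HamiltonianPoly ι R} :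
    ⁅f, g⁆ = 0 ↔ poisson f.1 g.1 = 0 := by
  rw [← coe_lie, ZeroMemClass.coe_eq_zero]

instance [Algebra ℚ R] : LieAlgebra ℚ (HamiltonianPoly ι R) where
  lie_smul t f g := Subtype.ext ((poisson f.1).map_smul_of_tower t g.1)

theorem isLieFiltration_orderFiltration [Algebra ℚ R] :
    IsLieFiltration (orderFiltration ι R) where
  antitone _ _ h _ hf := ordIdeal_antitone (Nat.add_le_add_right h 2) hf
  zero_eq_top := eq_top_iff.mpr fun f _ => f.2
  lie_mem {a b f g} hf hg :=
    mem_orderFiltration.mpr <| poisson_mem_ordIdeal (mem_orderFiltration.mp hf)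
      (mem_orderFiltration.mp hg) (by omega)

end HamiltonianPoly

section Oscillator

variable {ι : Type*} [Fintype ι]

section CommRing

variable {R : Type*} [CommRing R]

/-- The harmonic oscillator `∑ j, c_j ξ_j η_j` with frequencies proportional to `c`. -/
def oscillatorPoly (c : ι → R) : MvPolynomial (ι ⊕ ι) R := ∑ j, c j • actionPoly R j

/-- The eigenvalue of the bracket with the harmonic oscillator on the monomial of exponent `α`. -/
def smallDivisor (c : ι → R) (α : ι ⊕ ι →₀ ℕ) : R :=
  ∑ j, ((α (Sum.inl j) : ℤ) - α (Sum.inr j)) • c j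

theorem oscillatorPoly_mem_ordIdeal (c : ι → R) : oscillatorPoly c ∈ ordIdeal (ι ⊕ ι) R 2 :=
  sum_mem fun j _ => Submodule.smul_of_tower_mem _ (c j) (actionPoly_mem_ordIdeal j)

theorem coeff_poisson_oscillatorPoly (c : ι → R) (f : MvPolynomial (ι ⊕ ι) R)
    (α : ι ⊕ ι →₀ ℕ) :
    coeff α (poisson f (oscillatorPoly c)) = smallDivisor c α * coeff α f := by
  simp only [oscillatorPoly, smallDivisor, map_sum, Derivation.map_smul, coeff_sum, coeff_smul,
    coeff_poisson_actionPoly, smul_eq_mul, Finset.sum_mul, zsmul_eq_mul]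
  exact Finset.sum_congr rfl fun j _ => by push_cast; ring

theorem poisson_actionPoly_actionPoly (i j : ι) :
    poisson (actionPoly R i) (actionPoly R j) = 0 := by
  classical
  ext α
  rw [coeff_poisson_actionPoly, actionPoly, X, X, monomial_mul, coeff_monomial]
  split_ifs with h
  · simp [← h, Finsupp.single_apply]
  · simp

theorem poisson_actionPoly_oscillatorPoly (c : ι → R) (j : ι) :
    poisson (actionPoly R j) (oscillatorPoly c) = 0 := by
  simp [oscillatorPoly, poisson_actionPoly_actionPoly]

theorem smallDivisor_eq_zero_iff {c : ι → R} (hc : LinearIndependent ℤ c) (α : ι ⊕ ι →₀ ℕ) :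
    smallDivisor c α = 0 ↔ ∀ j, α (Sum.inl j) = α (Sum.inr j) := by
  refine ⟨fun h j => ?_, fun h => Finset.sum_eq_zero fun j _ => by rw [h, sub_self, zero_smul]⟩
  have := Fintype.linearIndependent_iff.mp hc _ h j
  omega

theorem degree_even_of_smallDivisor_eq_zero {c : ι → R} (hc : LinearIndependent ℤ c)
    {α : ι ⊕ ι →₀ ℕ} (hα : smallDivisor c α = 0) : Even α.degree := by
  rw [smallDivisor_eq_zero_iff hc] at hα
  rw [Finsupp.degree_eq_sum, Fintype.sum_sum_type, Finset.sum_congr rfl fun j _ => hα j]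
  exact Even.add_self _

end CommRing

theorem exists_coeff_eq_coeff_mul {σ R : Type*} [CommSemiring R] (p : MvPolynomial σ R)
    (w : (σ →₀ ℕ) → R) : ∃ q : MvPolynomial σ R, ∀ α, coeff α q = coeff α p * w α := by
  classical
  refine ⟨∑ β ∈ p.support, monomial β (coeff β p * w β), fun α => ?_⟩
  rw [coeff_sum]
  simp only [coeff_monomial, Finset.sum_ite_eq', mem_support_iff, ne_eq, ite_not]
  split_ifs with h
  · rw [h, zero_mul]
  · rfl

section Field

variable {K : Type*} [Field K] {c : ι → K}

theorem exists_homological_solution (hc : LinearIndependent ℤ c) {m : ℕ}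
    {f : MvPolynomial (ι ⊕ ι) K} (hf : f ∈ ordIdeal (ι ⊕ ι) K m) :
    ∃ χ ∈ ordIdeal (ι ⊕ ι) K m,
      ∀ j, poisson (actionPoly K j) (f + poisson χ (oscillatorPoly c)) = 0 := by
  obtain ⟨χ, hχ⟩ := exists_coeff_eq_coeff_mul f fun α => -(smallDivisor c α)⁻¹
  rw [mem_ordIdeal_iff_coeff] at hf
  refine ⟨χ, mem_ordIdeal_iff_coeff.mpr fun α hα => by rw [hχ, hf α hα, zero_mul], fun j => ?_⟩
  ext α
  rw [poisson_swap, coeff_neg, coeff_poisson_actionPoly, coeff_add, coeff_poisson_oscillatorPoly,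
    hχ, coeff_zero, neg_eq_zero]
  by_cases h : smallDivisor c α = 0
  · rw [(smallDivisor_eq_zero_iff hc α).mp h, sub_self, zero_mul]
  · field_simp
    ring

/-- Cubic polynomials have no resonant monomials, so the homological equation determines the
cubic part of an approximate integral. -/
theorem sub_mem_ordIdeal_four (hc : LinearIndependent ℤ c) {h h' : MvPolynomial (ι ⊕ ι) K}
    (hh : h - oscillatorPoly c ∈ ordIdeal (ι ⊕ ι) K 3) (hh' : h' - h ∈ ordIdeal (ι ⊕ ι) K 4)
    {Φ Φ' : MvPolynomial (ι ⊕ ι) K} (hΦ' : Φ' ∈ ordIdeal (ι ⊕ ι) K 2)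
    (hΦ : Φ' - Φ ∈ ordIdeal (ι ⊕ ι) K 3) (hp : poisson Φ h ∈ ordIdeal (ι ⊕ ι) K 4)
    (hp' : poisson Φ' h' ∈ ordIdeal (ι ⊕ ι) K 4) : Φ' - Φ ∈ ordIdeal (ι ⊕ ι) K 4 := by
  have poisson_mem : poisson (Φ' - Φ) (oscillatorPoly c) ∈ ordIdeal (ι ⊕ ι) K 4 := by
    have split : poisson (Φ' - Φ) (oscillatorPoly c) = poisson Φ' h' - poisson Φ h -
        poisson Φ' (h' - h) - poisson (Φ' - Φ) (h - oscillatorPoly c) := by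
      have : poisson Φ' = poisson (Φ' - Φ) + poisson Φ := by
        rw [← poisson_add, sub_add_cancel]
      simp only [map_sub, this, Derivation.add_apply]
      ring
    rw [split]
    exact sub_mem (sub_mem (sub_mem hp' hp) (poisson_mem_ordIdeal hΦ' hh' le_rfl))
      (poisson_mem_ordIdeal hΦ hh le_rfl)
  rw [mem_ordIdeal_iff_coeff] at hΦ poisson_mem ⊢
  intro α hα
  rcases (Nat.le_of_lt_succ hα).lt_or_eq with hlt | heq
  · exact hΦ α hlt
  · have := poisson_mem α hα
    rw [coeff_poisson_oscillatorPoly] at this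
    refine (mul_eq_zero.mp this).resolve_left fun h0 => ?_
    exact absurd (degree_even_of_smallDivisor_eq_zero hc h0) (by rw [heq]; decide)

end Field

theorem exists_approximate_integral {K : Type*} [Field K] [CharZero K] {c : ι → K}
    (hc : LinearIndependent ℤ c) {h : MvPolynomial (ι ⊕ ι) K}
    (hh : h - oscillatorPoly c ∈ ordIdeal (ι ⊕ ι) K 3) (N : ℕ) (j : ι) :
    ∃ Φ : MvPolynomial (ι ⊕ ι) K, Φ - actionPoly K j ∈ ordIdeal (ι ⊕ ι) K 3 ∧
      poisson Φ h ∈ ordIdeal (ι ⊕ ι) K N := by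
  have hh_order : h ∈ ordIdeal (ι ⊕ ι) K 2 := by
    rw [← sub_add_cancel h (oscillatorPoly c)]
    exact add_mem (ordIdeal_antitone (by norm_num) hh) (oscillatorPoly_mem_ordIdeal c)
  let h₀ : HamiltonianPoly ι K := ⟨oscillatorPoly c, oscillatorPoly_mem_ordIdeal c⟩
  let s (j : ι) : HamiltonianPoly ι K := ⟨actionPoly K j, actionPoly_mem_ordIdeal j⟩
  have hs (j : ι) : ⁅s j, h₀⁆ = 0 :=
    HamiltonianPoly.lie_eq_zero.mpr (poisson_actionPoly_oscillatorPoly c j)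
  have hh₀ : ⟨h, hh_order⟩ - h₀ ∈ orderFiltration ι K 1 := mem_orderFiltration.mpr hh
  have hom : HomologicallySolvable (orderFiltration ι K) s h₀ := fun m f hf => by
    obtain ⟨χ, hχ, hχf⟩ := exists_homological_solution hc (mem_orderFiltration.mp hf)
    exact ⟨⟨χ, ordIdeal_antitone (by omega) hχ⟩, mem_orderFiltration.mpr hχ,
      fun j => HamiltonianPoly.lie_eq_zero.mpr (hχf j)⟩
  have hF : IsLieFiltration (orderFiltration ι K) := isLieFiltration_orderFiltration
  obtain ⟨Φ, hΦ, hΦh⟩ := hF.exists_lie_mem N hh₀ hs hom j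
  rw [mem_orderFiltration] at hΦ hΦh
  exact ⟨Φ.1, hΦ, ordIdeal_antitone (by omega : N ≤ N + 2) hΦh⟩

end Oscillator

/-! ### Polynomials in complex coordinates and Taylor's formula -/

section Asymptotics

variable {E F : Type*} [NormedAddCommGroup E] [NormedAddCommGroup F]

theorem isBigO_norm_pow_mono {f : E → F} {a b : ℕ} (hab : a ≤ b)
    (hf : f =O[𝓝 0] fun z => ‖z‖ ^ b) : f =O[𝓝 0] fun z => ‖z‖ ^ a := by
  refine hf.trans (IsBigO.of_bound 1 ?_)
  filter_upwards [Metric.ball_mem_nhds (0 : E) one_pos] with z hz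
  rw [mem_ball_zero_iff] at hz
  simpa using pow_le_pow_of_le_one (norm_nonneg z) hz.le hab

theorem isBigO_norm_pow_zero {f : E → F} (hf : ContinuousAt f 0) :
    f =O[𝓝 0] fun z => ‖z‖ ^ 0 := by
  simpa only [pow_zero] using hf.tendsto.isBigO_one ℝ

variable [NormedSpace ℝ E]

theorem eq_zero_of_isBigO_of_homogeneous {f : E → F} {m : ℕ}
    (hf : f =O[𝓝 0] fun z => ‖z‖ ^ (m + 1))
    (hom : ∀ (t : ℝ) (z : E), ‖f (t • z)‖ = |t| ^ m * ‖f z‖) : f = 0 := by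
  ext z
  have hray : Tendsto (fun t : ℝ => t • z) (𝓝[>] 0) (𝓝 0) :=
    tendsto_nhdsWithin_of_tendsto_nhds (Continuous.tendsto' (by fun_prop) _ _ (zero_smul ℝ z))
  obtain ⟨c, hc⟩ := (hf.comp_tendsto hray).bound
  have hle : ∀ᶠ t : ℝ in 𝓝[>] 0, ‖f z‖ ≤ c * ‖z‖ ^ (m + 1) * t := by
    filter_upwards [hc, self_mem_nhdsWithin] with t ht (htpos : 0 < t)
    simp only [Function.comp_apply, hom, norm_pow, norm_smul, Real.norm_eq_abs,
      abs_mul, abs_norm, abs_of_pos htpos] at ht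
    exact le_of_mul_le_mul_left (ht.trans_eq (by ring)) (pow_pos htpos m)
  exact norm_le_zero_iff.1 (ge_of_tendsto (tendsto_nhdsWithin_of_tendsto_nhds
    (Continuous.tendsto' (by fun_prop) _ _ (mul_zero _))) hle)

variable [NormedSpace ℝ F]

theorem norm_fderiv_le_of_lipschitzOnWith {g : E → F} {z : E} {r c : ℝ} {K : NNReal} {s : Set E}
    (hr : 0 < r) (hs : Metric.closedBall z r ⊆ s) (hd : ∀ x ∈ s, DifferentiableAt ℝ g x)
    (hK : LipschitzOnWith K (fderiv ℝ g) s)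
    (hc : ∀ x ∈ Metric.closedBall z r, ‖g x‖ ≤ c * r ^ 2) :
    ‖fderiv ℝ g z‖ ≤ (2 * c + K) * r := by
  have hz := Metric.mem_closedBall_self (x := z) hr.le
  have hc0 : 0 ≤ c := nonneg_of_mul_nonneg_left ((norm_nonneg _).trans (hc z hz)) (by positivity)
  refine ContinuousLinearMap.opNorm_le_of_unit_norm (by positivity) fun u hu => ?_
  have hru : ‖r • u‖ = r := by rw [norm_smul, hu, mul_one, Real.norm_of_nonneg hr.le]
  have hy : z + r • u ∈ Metric.closedBall z r := by
    rw [mem_closedBall_iff_norm, add_sub_cancel_left, hru]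
  have htaylor : ‖g (z + r • u) - g z - fderiv ℝ g z (r • u)‖ ≤ K * r * r := by
    have := (convex_closedBall z r).norm_image_sub_le_of_norm_fderiv_le' (𝕜 := ℝ) (f := g)
      (φ := fderiv ℝ g z) (C := K * r) (fun x hx => hd x (hs hx)) (fun x hx => ?_) hz hy
    · rwa [add_sub_cancel_left, hru] at this
    · refine (hK.norm_sub_le (hs hx) (hs hz)).trans ?_
      gcongr
      exact mem_closedBall_iff_norm.1 hx
  refine le_of_mul_le_mul_left ?_ hr
  calc r * ‖fderiv ℝ g z u‖ = ‖fderiv ℝ g z (r • u)‖ := by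
        rw [map_smul, norm_smul, Real.norm_of_nonneg hr.le]
    _ = ‖g (z + r • u) - g z - (g (z + r • u) - g z - fderiv ℝ g z (r • u))‖ := by
        rw [sub_sub_cancel]
    _ ≤ ‖g (z + r • u)‖ + ‖g z‖ + ‖g (z + r • u) - g z - fderiv ℝ g z (r • u)‖ :=
        (norm_sub_le _ _).trans (by gcongr; exact norm_sub_le _ _)
    _ ≤ c * r ^ 2 + c * r ^ 2 + K * r * r := by gcongr <;> exact hc _ ‹_›
    _ = r * ((2 * c + K) * r) := by ring

/-- The second derivative is bounded, so a loss of half of the order of vanishing pays for the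
passage to the first derivative. -/
theorem isBigO_fderiv_of_isBigO {g : E → F} {N : ℕ} (hg : ContDiffAt ℝ 2 g 0) (hN : 1 ≤ N)
    (hO : g =O[𝓝 0] fun z => ‖z‖ ^ (2 * N)) : fderiv ℝ g =O[𝓝 0] fun z => ‖z‖ ^ N := by
  obtain ⟨K, s, hs, hK⟩ :=
    (hg.fderiv_right (m := 1) (by norm_num)).exists_lipschitzOnWith
  obtain ⟨c, hc0, hc⟩ := hO.exists_nonneg
  have hd : ∀ᶠ x in 𝓝 (0 : E), DifferentiableAt ℝ g x :=
    (hg.eventually (by simp)).mono fun x hx => hx.differentiableAt (by simp)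
  obtain ⟨δ, hδ, hball⟩ := Metric.eventually_nhds_iff_ball.1 ((hc.bound.and hd).and hs)
  refine IsBigO.of_bound (2 * (c * 2 ^ (2 * N)) + K) ?_
  filter_upwards [Metric.ball_mem_nhds (0 : E) (ε := min 1 (δ / 2)) (by positivity)] with z hz
  rw [mem_ball_zero_iff, lt_min_iff] at hz
  rw [norm_pow, norm_norm]
  rcases eq_or_ne z 0 with rfl | hz0
  · have h0 : HasFDerivAt g (0 : E →L[ℝ] F) 0 :=
      IsBigO.hasFDerivAt (n := 2 * N) (by simpa only [sub_zero] using hO) (by omega)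
    rw [h0.fderiv, norm_zero, norm_zero, zero_pow (by omega), mul_zero]
  have hpow : ‖z‖ ^ N ≤ ‖z‖ := pow_le_of_le_one (norm_nonneg z) hz.1.le (by omega)
  have hle {x : E} (hx : x ∈ Metric.closedBall z (‖z‖ ^ N)) : ‖x‖ ≤ 2 * ‖z‖ := by
    have := norm_le_norm_add_norm_sub' x z
    have := mem_closedBall_iff_norm.1 hx
    linarith
  have hmem {x : E} (hx : x ∈ Metric.closedBall z (‖z‖ ^ N)) : x ∈ Metric.ball (0 : E) δ := by
    have := hle hx
    rw [mem_ball_zero_iff]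
    linarith
  refine norm_fderiv_le_of_lipschitzOnWith (s := Metric.ball 0 δ) (pow_pos (norm_pos_iff.2 hz0) N)
    (fun x hx => hmem hx) (fun x hx => (hball x hx).1.2) (hK.mono fun x hx => (hball x hx).2)
    fun x hx => ?_
  calc ‖g x‖ ≤ c * ‖x‖ ^ (2 * N) := by
        simpa only [norm_pow, norm_norm] using (hball x (hmem hx)).1.1
    _ ≤ c * (2 * ‖z‖) ^ (2 * N) := by gcongr; exact hle hx
    _ = c * 2 ^ (2 * N) * (‖z‖ ^ N) ^ 2 := by ring

theorem isBigO_sub_sum_iteratedFDeriv [CompleteSpace F] {f : E → F} {N : ℕ}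
    (hf : ContDiffAt ℝ (N + 1) f 0) :
    (fun z => f z - ∑ k ∈ Finset.range (N + 1),
      (k.factorial : ℝ)⁻¹ • iteratedFDeriv ℝ k f 0 fun _ => z) =O[𝓝 0]
        fun z => ‖z‖ ^ (N + 1) := by
  have hcont : ContinuousAt (iteratedFDeriv ℝ (N + 1) f) 0 :=
    (hf.iteratedFDeriv_right (m := 0) (i := N + 1) (by simp)).continuousAt
  obtain ⟨C, hC⟩ := (hcont.tendsto.isBigO_one ℝ).bound
  obtain ⟨δ, hδ, hball⟩ := Metric.eventually_nhds_iff_ball.1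
    (hC.and (hf.eventually (by simp)))
  refine IsBigO.of_bound ((N.factorial : ℝ)⁻¹ * C) ?_
  filter_upwards [Metric.ball_mem_nhds (0 : E) hδ] with z hz
  have hmem {t : ℝ} (ht : t ∈ Icc (0 : ℝ) 1) : 0 + t • z ∈ Metric.ball (0 : E) δ := by
    rw [zero_add, mem_ball_zero_iff, norm_smul, Real.norm_of_nonneg ht.1]
    exact (mul_le_of_le_one_left (norm_nonneg z) ht.2).trans_lt (mem_ball_zero_iff.1 hz)
  have htaylor := map_add_eq_sum_add_integral_iteratedFDeriv (n := N) (f := f) (x := 0) (y := z)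
    fun t ht => (hball _ (hmem ht)).2
  rw [zero_add] at htaylor
  rw [htaylor, add_sub_cancel_left, norm_smul, norm_inv, Real.norm_natCast, norm_pow, norm_norm,
    mul_assoc]
  gcongr
  refine (intervalIntegral.norm_integral_le_of_norm_le_const fun t ht => ?_).trans_eq
    (b := C * ‖z‖ ^ (N + 1) * |1 - 0|) (by simp)
  rw [uIoc_of_le zero_le_one] at ht
  have ht' : t ∈ Icc (0 : ℝ) 1 := Ioc_subset_Icc_self ht
  have hpow : ‖(1 - t) ^ N‖ ≤ 1 := by
    rw [norm_pow, Real.norm_of_nonneg (by linarith [ht.2])]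
    exact pow_le_one₀ (by linarith [ht.2]) (by linarith [ht.1])
  have hD : ‖iteratedFDeriv ℝ (N + 1) f (0 + t • z)‖ ≤ C := by
    simpa using (hball _ (hmem ht')).1
  calc ‖(1 - t) ^ N • iteratedFDeriv ℝ (N + 1) f (0 + t • z) fun _ => z‖
      ≤ 1 * (‖iteratedFDeriv ℝ (N + 1) f (0 + t • z)‖ * ∏ _ : Fin (N + 1), ‖z‖) := by
        rw [norm_smul]
        gcongr
        exact ContinuousMultilinearMap.le_opNorm _ _
    _ ≤ C * ‖z‖ ^ (N + 1) := by
        rw [one_mul, Finset.prod_const, Finset.card_univ, Fintype.card_fin]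
        gcongr

end Asymptotics

section EvalForms

variable {σ E : Type*} [NormedAddCommGroup E] [NormedSpace ℝ E]

/-- The complex function on a real normed space obtained from a polynomial by substituting the
linear forms `ℓ i` for the indeterminates. -/
def evalForms (ℓ : σ → E →L[ℝ] ℂ) : MvPolynomial σ ℂ →ₐ[ℂ] (E → ℂ) :=
  aeval fun i => ⇑(ℓ i)

variable (ℓ : σ → E →L[ℝ] ℂ)

theorem evalForms_apply (p : MvPolynomial σ ℂ) (z : E) :
    evalForms ℓ p z = eval (fun i => ℓ i z) p :=
  comp_aeval_apply (fun i => ⇑(ℓ i)) (Pi.evalAlgHom ℂ (fun _ : E => ℂ) z) p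

theorem evalForms_X (i : σ) : evalForms ℓ (X i) = ℓ i :=
  aeval_X _ i

theorem evalForms_C (a : ℂ) : evalForms ℓ (C a) = fun _ => a :=
  aeval_C _ a

theorem hasFDerivAt_evalForms [Fintype σ] (p : MvPolynomial σ ℂ) (z : E) :
    HasFDerivAt (evalForms ℓ p) (∑ i, evalForms ℓ (pderiv i p) z • ℓ i) z := by
  classical
  induction p using MvPolynomial.induction_on with
  | C a =>
    rw [evalForms_C]
    refine (hasFDerivAt_const (𝕜 := ℝ) a z).congr_fderiv ?_
    ext v
    simp
  | add p q hp hq =>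
    rw [map_add]
    refine (hp.add hq).congr_fderiv ?_
    ext v
    simp [add_mul, Finset.sum_add_distrib]
  | mul_X p i hp =>
    rw [map_mul, evalForms_X]
    refine (hp.mul (ℓ i).hasFDerivAt).congr_fderiv ?_
    ext v
    have hk (k : σ) : evalForms ℓ (pderiv k (p * X i)) z =
        (if i = k then evalForms ℓ p z else 0) + ℓ i z * evalForms ℓ (pderiv k p) z := by
      simp [pderiv_X, Pi.single_apply, apply_ite, ite_apply, evalForms_X]
    simp only [hk, add_apply, sum_apply, smul_apply, smul_eq_mul, add_mul, ite_mul, zero_mul,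
      Finset.sum_add_distrib, Finset.sum_ite_eq, Finset.mem_univ, if_true, Finset.mul_sum,
      mul_assoc]

theorem contDiff_evalForms (p : MvPolynomial σ ℂ) {m : WithTop ℕ∞} :
    ContDiff ℝ m (evalForms ℓ p) := by
  induction p using MvPolynomial.induction_on with
  | C a =>
    rw [evalForms_C]
    exact contDiff_const
  | add p q hp hq =>
    rw [map_add]
    exact hp.add hq
  | mul_X p i hp =>
    rw [map_mul, evalForms_X]
    exact hp.mul (ℓ i).contDiff

theorem isBigO_evalForms {m : ℕ} {p : MvPolynomial σ ℂ} (hp : p ∈ ordIdeal σ ℂ m) :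
    evalForms ℓ p =O[𝓝 0] fun z => ‖z‖ ^ m := by
  have hc (q : MvPolynomial σ ℂ) : evalForms ℓ q =O[𝓝 0] fun z => ‖z‖ ^ 0 :=
    isBigO_norm_pow_zero (contDiff_evalForms ℓ q (m := 0)).continuous.continuousAt
  induction m generalizing p with
  | zero => exact hc p
  | succ m ih =>
    rw [ordIdeal, pow_succ, idealOfVars] at hp
    refine Submodule.mul_induction_on hp (fun a ha b hb => ?_) fun a b ha hb => ?_
    · have hb1 : evalForms ℓ b =O[𝓝 0] fun z => ‖z‖ := by
        induction hb using Submodule.span_induction with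
        | mem _ hx =>
          obtain ⟨i, rfl⟩ := hx
          rw [evalForms_X]
          exact ((ℓ i).isBigO_id _).norm_right
        | zero => rw [map_zero]; exact isBigO_zero _ _
        | add x y _ _ hx hy => rw [map_add]; exact hx.add hy
        | smul c x _ hx => simpa [Pi.mul_def] using (hc c).mul hx
      simpa only [map_mul, pow_succ, Pi.mul_def] using (ih ha).mul hb1
    · rw [map_add]; exact ha.add hb

theorem evalForms_smul_of_isHomogeneous {m : ℕ} {p : MvPolynomial σ ℂ} (hp : p.IsHomogeneous m)
    (t : ℝ) (z : E) : evalForms ℓ p (t • z) = (t : ℂ) ^ m * evalForms ℓ p z := by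
  simp only [evalForms_apply, map_smul, eval_eq, Finset.mul_sum, Complex.real_smul, mul_pow,
    Finset.prod_mul_distrib]
  refine Finset.sum_congr rfl fun α hα => ?_
  have hd : ∑ i ∈ α.support, α i = m := by
    rw [← Finsupp.degree_apply, Finsupp.degree_eq_weight_one]
    exact hp (mem_support_iff.1 hα)
  rw [Finset.prod_pow_eq_pow_sum, hd]
  ring

variable {ℓ}

theorem mem_ordIdeal_of_isBigO (hℓ : Function.Injective (evalForms ℓ)) {m : ℕ}
    {p : MvPolynomial σ ℂ} (hp : evalForms ℓ p =O[𝓝 0] fun z => ‖z‖ ^ m) :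
    p ∈ ordIdeal σ ℂ m := by
  induction m with
  | zero => simp [ordIdeal]
  | succ m ih =>
    have hm := mem_ordIdeal_iff_coeff.1 (ih (isBigO_norm_pow_mono m.le_succ hp))
    have htail : p - homogeneousComponent m p ∈ ordIdeal σ ℂ (m + 1) := by
      refine mem_ordIdeal_iff_coeff.2 fun α hα => ?_
      rw [coeff_sub, coeff_homogeneousComponent]
      split_ifs with h
      · exact sub_self _
      · rw [hm α (by omega), sub_zero]
    have hO : evalForms ℓ (homogeneousComponent m p) =O[𝓝 0] fun z => ‖z‖ ^ (m + 1) := by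
      have h := hp.sub (isBigO_evalForms ℓ htail)
      rwa [← Pi.sub_def, ← map_sub, sub_sub_cancel] at h
    have h0 : homogeneousComponent m p = 0 :=
      hℓ <| by
        rw [map_zero]
        refine eq_zero_of_isBigO_of_homogeneous hO fun t z => ?_
        rw [evalForms_smul_of_isHomogeneous ℓ (homogeneousComponent_isHomogeneous m p), norm_mul,
          norm_pow, Complex.norm_real, Real.norm_eq_abs]
    rwa [h0, sub_zero] at htail

theorem exists_evalForms_eq_multilinearMap {ι : Type*} [Fintype ι] {e : ι → E}
    {x : ι → MvPolynomial σ ℂ} {a : ι → E → ℝ} (hx : ∀ i z, evalForms ℓ (x i) z = a i z)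
    (he : ∀ z, ∑ i, a i z • e i = z) {k : ℕ} (A : MultilinearMap ℝ (fun _ : Fin k => E) ℂ) :
    ∃ p, ∀ z, evalForms ℓ p z = A fun _ => z := by
  classical
  refine ⟨∑ r : Fin k → ι, C (A fun s => e (r s)) * ∏ s, x (r s), fun z => ?_⟩
  have hz : (A fun _ => z) = A fun _ => ∑ i, a i z • e i := by simp only [he]
  rw [hz, A.map_sum]
  simp only [A.map_smul_univ, map_sum, map_mul, map_prod, evalForms_C, Finset.sum_apply,
    Pi.mul_apply, Finset.prod_apply, hx, Complex.real_smul, Complex.ofReal_prod]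
  exact Finset.sum_congr rfl fun _ _ => mul_comm _ _

end EvalForms

section ComplexCoordinates

variable {n : ℕ}

/-- The complex coordinates `ξ_j = q_j + i p_j` and `η_j = q_j - i p_j` of the phase space, in which
the harmonic oscillator is diagonal. -/
def complexCoord : Fin n ⊕ Fin n → PhaseSpace n →L[ℝ] ℂ
  | Sum.inl j => Complex.ofRealCLM ∘L EuclideanSpace.proj (Sum.inl j) +
      Complex.I • (Complex.ofRealCLM ∘L EuclideanSpace.proj (Sum.inr j))
  | Sum.inr j => Complex.ofRealCLM ∘L EuclideanSpace.proj (Sum.inl j) -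
      Complex.I • (Complex.ofRealCLM ∘L EuclideanSpace.proj (Sum.inr j))

theorem complexCoord_inl (j : Fin n) (z : PhaseSpace n) :
    complexCoord (Sum.inl j) z = z (Sum.inl j) + Complex.I * z (Sum.inr j) :=
  rfl

theorem complexCoord_inr (j : Fin n) (z : PhaseSpace n) :
    complexCoord (Sum.inr j) z = z (Sum.inl j) - Complex.I * z (Sum.inr j) :=
  rfl

/-- The polynomials in the complex coordinates that represent `q_j` and `p_j`. -/
def realCoordPoly : Fin n ⊕ Fin n → MvPolynomial (Fin n ⊕ Fin n) ℂ
  | Sum.inl j => C (1 / 2) * (X (Sum.inl j) + X (Sum.inr j))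
  | Sum.inr j => C (-Complex.I / 2) * (X (Sum.inl j) - X (Sum.inr j))

theorem evalForms_realCoordPoly (i : Fin n ⊕ Fin n) (z : PhaseSpace n) :
    evalForms complexCoord (realCoordPoly i) z = z i := by
  rcases i with j | j <;>
    simp only [realCoordPoly, evalForms_apply, map_mul, map_add, map_sub, eval_C, eval_X,
      complexCoord_inl, complexCoord_inr]
  · ring
  · linear_combination -(z (Sum.inr j) : ℂ) * Complex.I_sq

theorem evalForms_complexCoord_injective :
    Function.Injective (evalForms (complexCoord (n := n))) := by
  refine (injective_iff_map_eq_zero _).2 fun p hp => ?_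
  set φ : Fin n ⊕ Fin n → MvPolynomial (Fin n ⊕ Fin n) ℂ := Sum.elim
    (fun j => X (Sum.inl j) + C Complex.I * X (Sum.inr j))
    (fun j => X (Sum.inl j) - C Complex.I * X (Sum.inr j)) with hφ
  have hq : bind₁ φ p = 0 := by
    refine funext_set (fun _ => range ((↑) : ℝ → ℂ))
      (fun _ => infinite_range_of_injective Complex.ofReal_injective) fun w hw => ?_
    choose x hx using fun i => hw i (mem_univ i)
    have hpx := congrFun hp (WithLp.toLp 2 x)
    rw [evalForms_apply, Pi.zero_apply] at hpx
    rw [map_zero, ← hpx, eval, eval₂Hom_bind₁]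
    refine congr_arg (fun y => eval y p) (_root_.funext fun i => ?_)
    rcases i with j | j <;> simp [hφ, complexCoord_inl, complexCoord_inr, ← hx]
  refine MvPolynomial.funext fun w => ?_
  have hw := congr_arg (eval fun i => eval w (realCoordPoly i)) hq
  rw [map_zero, eval, eval₂Hom_bind₁] at hw
  rw [map_zero, ← hw]
  refine congr_arg (fun y => eval y p) (_root_.funext fun i => ?_)
  rcases i with j | j <;>
    simp only [hφ, Sum.elim_inl, Sum.elim_inr, realCoordPoly, map_mul, map_add, map_sub,
      eval₂Hom_X', eval₂Hom_C, RingHom.id_apply, eval_X, eval_C]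
  · linear_combination (w (Sum.inl j) - w (Sum.inr j)) / 2 * Complex.I_sq
  · linear_combination (w (Sum.inr j) - w (Sum.inl j)) / 2 * Complex.I_sq

theorem exists_isBigO_sub_evalForms {f : PhaseSpace n → ℂ} {N : ℕ}
    (hf : ContDiffAt ℝ (N + 1) f 0) :
    ∃ p, (fun z => f z - evalForms complexCoord p z) =O[𝓝 0] fun z => ‖z‖ ^ (N + 1) := by
  have hbasis (z : PhaseSpace n) : ∑ i, z i • EuclideanSpace.single i (1 : ℝ) = z := by
    simpa using (EuclideanSpace.basisFun (Fin n ⊕ Fin n) ℝ).sum_repr z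
  choose p hp using fun k => exists_evalForms_eq_multilinearMap (ℓ := complexCoord)
    evalForms_realCoordPoly hbasis (iteratedFDeriv ℝ k f 0).toMultilinearMap
  refine ⟨∑ k ∈ Finset.range (N + 1), (k.factorial : ℂ)⁻¹ • p k,
    (isBigO_sub_sum_iteratedFDeriv hf).congr_left fun z => ?_⟩
  simp [hp]

theorem fderiv_evalForms_single_inl (p : MvPolynomial (Fin n ⊕ Fin n) ℂ) (z : PhaseSpace n)
    (j : Fin n) :
    fderiv ℝ (evalForms complexCoord p) z (EuclideanSpace.single (Sum.inl j) 1) =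
      evalForms complexCoord (pderiv (Sum.inl j) p) z +
        evalForms complexCoord (pderiv (Sum.inr j) p) z := by
  rw [(hasFDerivAt_evalForms _ p z).fderiv]
  simp [complexCoord_inl, complexCoord_inr, apply_ite ((↑) : ℝ → ℂ)]

theorem fderiv_evalForms_single_inr (p : MvPolynomial (Fin n ⊕ Fin n) ℂ) (z : PhaseSpace n)
    (j : Fin n) :
    fderiv ℝ (evalForms complexCoord p) z (EuclideanSpace.single (Sum.inr j) 1) =
      Complex.I * (evalForms complexCoord (pderiv (Sum.inl j) p) z -
        evalForms complexCoord (pderiv (Sum.inr j) p) z) := by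
  rw [(hasFDerivAt_evalForms _ p z).fderiv]
  simp only [Fintype.sum_sum_type, add_apply, sum_apply, smul_apply, complexCoord_inl, ne_eq,
    reduceCtorEq, not_false_eq_true, PiLp.single_eq_of_ne, Complex.ofReal_zero, PiLp.single_apply,
    Sum.inr.injEq, apply_ite ((↑) : ℝ → ℂ), Complex.ofReal_one, mul_ite, mul_one, mul_zero,
    zero_add, smul_eq_mul, Finset.sum_ite_eq', Finset.mem_univ, ↓reduceIte, complexCoord_inr,
    zero_sub, mul_neg, Finset.sum_neg_distrib]
  ring

/-- The Poisson bracket of two functions with differentials `L` and `L'`. -/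
def symplecticPairing (L L' : PhaseSpace n →L[ℝ] ℂ) : ℂ :=
  ∑ j, (L (EuclideanSpace.single (Sum.inl j) 1) * L' (EuclideanSpace.single (Sum.inr j) 1) -
    L (EuclideanSpace.single (Sum.inr j) 1) * L' (EuclideanSpace.single (Sum.inl j) 1))

theorem symplecticPairing_add_right (L L₁ L₂ : PhaseSpace n →L[ℝ] ℂ) :
    symplecticPairing L (L₁ + L₂) = symplecticPairing L L₁ + symplecticPairing L L₂ := by
  simp only [symplecticPairing, ← Finset.sum_add_distrib, add_apply]
  exact Finset.sum_congr rfl fun j _ => by ring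

theorem norm_symplecticPairing_le (L L' : PhaseSpace n →L[ℝ] ℂ) :
    ‖symplecticPairing L L'‖ ≤ 2 * n * (‖L‖ * ‖L'‖) := by
  have hle (L : PhaseSpace n →L[ℝ] ℂ) (i : Fin n ⊕ Fin n) :
      ‖L (EuclideanSpace.single i 1)‖ ≤ ‖L‖ :=
    L.unit_le_opNorm _ (by simp)
  refine (norm_sum_le_of_le _ fun j _ => norm_sub_le_of_le
    (norm_mul_le_of_le (hle L (Sum.inl j)) (hle L' (Sum.inr j)))
    (norm_mul_le_of_le (hle L (Sum.inr j)) (hle L' (Sum.inl j)))).trans_eq ?_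
  rw [Finset.sum_const, Finset.card_univ, Fintype.card_fin, nsmul_eq_mul]
  ring

theorem symplecticPairing_fderiv_evalForms (p h : MvPolynomial (Fin n ⊕ Fin n) ℂ)
    (z : PhaseSpace n) :
    symplecticPairing (fderiv ℝ (evalForms complexCoord p) z)
        (fderiv ℝ (evalForms complexCoord h) z) =
      -2 * Complex.I * evalForms complexCoord (poisson p h) z := by
  simp only [symplecticPairing, fderiv_evalForms_single_inl, fderiv_evalForms_single_inr,
    poisson_apply, map_sum, map_sub, map_mul, Finset.sum_apply, Pi.sub_apply, Pi.mul_apply,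
    Finset.mul_sum]
  exact Finset.sum_congr rfl fun j _ => by ring

theorem apply_hamiltonianVectorField (L : PhaseSpace n →L[ℝ] ℂ) (H : PhaseSpace n → ℝ)
    (z : PhaseSpace n) :
    L (hamiltonianVectorField H z) =
      symplecticPairing L (Complex.ofRealCLM ∘L fderiv ℝ H z) := by
  have hbasis := (EuclideanSpace.basisFun (Fin n ⊕ Fin n) ℝ).sum_repr (hamiltonianVectorField H z)
  rw [← hbasis, map_sum, Fintype.sum_sum_type, ← Finset.sum_add_distrib]
  refine Finset.sum_congr rfl fun j _ => ?_
  simp only [hamiltonianVectorField, partialP, partialQ, EuclideanSpace.basisFun_repr, Sum.elim_inl,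
    EuclideanSpace.basisFun_apply, map_smul, Complex.real_smul, Sum.elim_inr, neg_smul, map_neg,
    ContinuousLinearMap.comp_apply, Complex.ofRealCLM_apply]
  ring

theorem isBigO_fderiv_hamiltonianVectorField {H : PhaseSpace n → ℝ}
    {p h : MvPolynomial (Fin n ⊕ Fin n) ℂ} {N : ℕ} (hH : ContDiffAt ℝ 2 H 0) (hN : 1 ≤ N)
    (hHh : (fun z => (H z : ℂ) - evalForms complexCoord h z) =O[𝓝 0] fun z => ‖z‖ ^ (2 * N))
    (hp : poisson p h ∈ ordIdeal (Fin n ⊕ Fin n) ℂ N) :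
    (fun z => fderiv ℝ (evalForms complexCoord p) z (hamiltonianVectorField H z)) =O[𝓝 0]
      fun z => ‖z‖ ^ N := by
  set g : PhaseSpace n → ℂ := fun z => (H z : ℂ) - evalForms complexCoord h z
  have hrem : fderiv ℝ g =O[𝓝 0] fun z => ‖z‖ ^ N :=
    isBigO_fderiv_of_isBigO ((Complex.ofRealCLM.contDiff.contDiffAt.comp 0 hH).sub
      (contDiff_evalForms _ h).contDiffAt) hN hHh
  have hpairing : (fun z => symplecticPairing (fderiv ℝ (evalForms complexCoord p) z)
      (fderiv ℝ g z)) =O[𝓝 0] fun z => ‖z‖ ^ N := by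
    have hDp := isBigO_norm_pow_zero (E := PhaseSpace n)
      ((contDiff_evalForms complexCoord p (m := 1)).continuous_fderiv (by simp)).continuousAt
    refine IsBigO.trans (IsBigO.of_bound (2 * n) (Eventually.of_forall fun z => ?_))
      ((hDp.norm_left.mul hrem.norm_left).congr_right fun z => by rw [pow_zero, one_mul])
    rw [norm_mul, norm_norm, norm_norm]
    exact norm_symplecticPairing_le _ _
  refine (((isBigO_evalForms complexCoord hp).const_mul_left (-2 * Complex.I)).add
    hpairing).congr' ?_ EventuallyEq.rfl
  filter_upwards [hH.eventually (by simp)] with z hz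
  have hdH := Complex.ofRealCLM.hasFDerivAt.comp z (hz.differentiableAt (by simp)).hasFDerivAt
  have hdh := (hasFDerivAt_evalForms complexCoord h z).differentiableAt.hasFDerivAt
  have hdg : fderiv ℝ g z = _ := (hdH.sub hdh).fderiv
  rw [apply_hamiltonianVectorField, ← symplecticPairing_fderiv_evalForms,
    ← symplecticPairing_add_right, hdg, add_sub_cancel]

theorem evalForms_actionPoly (j : Fin n) (z : PhaseSpace n) :
    evalForms complexCoord (actionPoly ℂ j) z = ((2 * action j z : ℝ) : ℂ) := by
  simp only [evalForms_apply, actionPoly, map_mul, eval_X, complexCoord_inl, complexCoord_inr,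
    action]
  push_cast
  linear_combination (-(z (Sum.inr j) : ℂ) ^ 2) * Complex.I_sq

theorem evalForms_oscillatorPoly (ω : Fin n → ℝ) (z : PhaseSpace n) :
    evalForms complexCoord (oscillatorPoly fun j => (ω j : ℂ) / 2) z =
      (harmonicOscillator ω z : ℂ) := by
  simp only [oscillatorPoly, map_sum, map_smul, Finset.sum_apply, Pi.smul_apply,
    evalForms_actionPoly, harmonicOscillator, smul_eq_mul]
  push_cast
  exact Finset.sum_congr rfl fun j _ => by ring

theorem linearIndependent_of_nonResonant {ω : Fin n → ℝ} (hω : NonResonant ω) :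
    LinearIndependent ℤ fun j => (ω j : ℂ) / 2 := by
  refine Fintype.linearIndependent_iff.2 fun k hk => ?_
  by_contra! hne
  refine hω k (fun h0 => hne.elim fun j hj => hj (congrFun h0 j)) ?_
  have h2 : ((∑ j, (k j : ℝ) * ω j : ℝ) : ℂ) = 2 * ∑ j, k j • ((ω j : ℂ) / 2) := by
    push_cast
    rw [Finset.mul_sum]
    exact Finset.sum_congr rfl fun j _ => by rw [zsmul_eq_mul]; ring
  rw [hk, mul_zero] at h2
  exact_mod_cast h2

theorem exists_evalForms_approximation {ω : Fin n → ℝ} {H : PhaseSpace n → ℝ}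
    (hH : ContDiffAt ℝ (⊤ : ℕ∞) H 0)
    (hH3 : (fun z => H z - harmonicOscillator ω z) =O[𝓝 0] fun z => ‖z‖ ^ 3) {N : ℕ}
    (hN : 2 ≤ N) :
    ∃ h, h - oscillatorPoly (fun j => (ω j : ℂ) / 2) ∈ ordIdeal (Fin n ⊕ Fin n) ℂ 3 ∧
      (fun z => (H z : ℂ) - evalForms complexCoord h z) =O[𝓝 0] fun z => ‖z‖ ^ (N + 1) := by
  obtain ⟨h, hh⟩ := exists_isBigO_sub_evalForms (N := N)
    ((Complex.ofRealCLM.contDiff.contDiffAt.comp 0 hH).of_le (by exact_mod_cast le_top))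
  refine ⟨h, mem_ordIdeal_of_isBigO evalForms_complexCoord_injective ?_, hh⟩
  have hH3' : (fun z => ((H z - harmonicOscillator ω z : ℝ) : ℂ)) =O[𝓝 0]
      fun z : PhaseSpace n => ‖z‖ ^ 3 :=
    (Complex.ofRealCLM.isBigO_comp _ _).trans hH3
  refine (hH3'.sub (isBigO_norm_pow_mono (by omega) hh)).congr_left fun z => ?_
  rw [map_sub, Pi.sub_apply, evalForms_oscillatorPoly, Complex.ofReal_sub,
    Function.comp_apply, Complex.ofRealCLM_apply]
  ring

theorem exists_approximate_integral_of_hamiltonianVectorField {ω : Fin n → ℝ} (hω : NonResonant ω)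
    {H : PhaseSpace n → ℝ} (hH : ContDiffAt ℝ (⊤ : ℕ∞) H 0)
    (hH3 : (fun z => H z - harmonicOscillator ω z) =O[𝓝 0] fun z => ‖z‖ ^ 3) (j : Fin n) :
    ∃ Ψ, Ψ - actionPoly ℂ j ∈ ordIdeal (Fin n ⊕ Fin n) ℂ 3 ∧
      ∀ N, ∃ Φ, Φ - Ψ ∈ ordIdeal (Fin n ⊕ Fin n) ℂ 4 ∧
        (fun z => fderiv ℝ (evalForms complexCoord Φ) z (hamiltonianVectorField H z)) =O[𝓝 0]
          fun z => ‖z‖ ^ N := by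
  have hc := linearIndependent_of_nonResonant hω
  obtain ⟨h, hh, hHh⟩ := exists_evalForms_approximation hH hH3 (N := 3) (by omega)
  obtain ⟨Ψ, hΨ, hΨh⟩ := exists_approximate_integral hc hh 4 j
  refine ⟨Ψ, hΨ, fun N => ?_⟩
  obtain ⟨h', hh', hHh'⟩ := exists_evalForms_approximation hH hH3 (N := 2 * N + 7) (by omega)
  obtain ⟨Φ, hΦ, hΦh'⟩ := exists_approximate_integral hc hh' (N + 4) j
  have hdiff : h' - h ∈ ordIdeal (Fin n ⊕ Fin n) ℂ 4 := by
    refine mem_ordIdeal_of_isBigO evalForms_complexCoord_injective ?_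
    refine (hHh.sub (isBigO_norm_pow_mono (by omega) hHh')).congr_left fun z => ?_
    rw [map_sub, Pi.sub_apply, sub_sub_sub_cancel_left]
  have hΦΨ : Φ - Ψ ∈ ordIdeal (Fin n ⊕ Fin n) ℂ 3 := by
    simpa only [sub_sub_sub_cancel_right] using sub_mem hΦ hΨ
  have hΦ2 : Φ ∈ ordIdeal (Fin n ⊕ Fin n) ℂ 2 := by
    simpa only [sub_add_cancel] using
      add_mem (ordIdeal_antitone (by omega) hΦ) (actionPoly_mem_ordIdeal j)
  refine ⟨Φ, sub_mem_ordIdeal_four hc hh hdiff hΦ2 hΦΨ hΨh (ordIdeal_antitone (by omega) hΦh'), ?_⟩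
  exact isBigO_norm_pow_mono (by omega) (isBigO_fderiv_hamiltonianVectorField
    (hH.of_le (WithTop.coe_le_coe.2 le_top)) (by omega) hHh' hΦh')

theorem hasFDerivAt_re_evalForms_div_two (Φ : MvPolynomial (Fin n ⊕ Fin n) ℂ) (z : PhaseSpace n) :
    HasFDerivAt (fun z => (evalForms complexCoord Φ z).re / 2)
      ((2 : ℝ)⁻¹ • (Complex.reCLM ∘L fderiv ℝ (evalForms complexCoord Φ) z)) z := by
  have hΦ := (hasFDerivAt_evalForms complexCoord Φ z).differentiableAt.hasFDerivAt
  simp only [div_eq_inv_mul]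
  exact (Complex.reCLM.hasFDerivAt.comp z hΦ).const_mul (2 : ℝ)⁻¹

theorem exists_approximate_action {ω : Fin n → ℝ} (hω : NonResonant ω) {H : PhaseSpace n → ℝ}
    (hH : ContDiffAt ℝ (⊤ : ℕ∞) H 0)
    (hH3 : (fun z => H z - harmonicOscillator ω z) =O[𝓝 0] fun z => ‖z‖ ^ 3) (j : Fin n) :
    ∃ A > 0, ∀ N, ∃ G : PhaseSpace n → ℝ, Differentiable ℝ G ∧
      (∀ᶠ z in 𝓝 0, |G z - action j z| ≤ A * ‖z‖ ^ 3) ∧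
      (fun z => fderiv ℝ G z (hamiltonianVectorField H z)) =O[𝓝 0] fun z => ‖z‖ ^ N := by
  obtain ⟨Ψ, hΨ, hΦ⟩ := exists_approximate_integral_of_hamiltonianVectorField hω hH hH3 j
  obtain ⟨c, hc, hΨc⟩ := (isBigO_evalForms complexCoord hΨ).exists_pos
  refine ⟨c + 1, by positivity, fun N => ?_⟩
  obtain ⟨Φ, hΦΨ, hdrift⟩ := hΦ N
  have hG (z : PhaseSpace n) := hasFDerivAt_re_evalForms_div_two Φ z
  have hlittle : evalForms complexCoord (Φ - Ψ) =o[𝓝 0] fun z => ‖z‖ ^ 3 :=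
    (isBigO_evalForms complexCoord hΦΨ).trans_isLittleO (isLittleO_norm_pow_norm_pow (by norm_num))
  refine ⟨_, fun z => (hG z).differentiableAt, ?_, ?_⟩
  · filter_upwards [hΨc.bound, hlittle.bound one_pos] with z hz hz'
    have hsplit : (evalForms complexCoord Φ z).re / 2 - action j z =
        (evalForms complexCoord (Ψ - actionPoly ℂ j) z +
          evalForms complexCoord (Φ - Ψ) z).re / 2 := by
      simp only [map_sub, Pi.sub_apply, evalForms_actionPoly, Complex.add_re, Complex.sub_re,
        Complex.ofReal_re]
      ring
    rw [norm_pow, norm_norm] at hz hz'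
    rw [hsplit, abs_div, abs_two, add_mul]
    exact (half_le_self (abs_nonneg _)).trans
      ((Complex.abs_re_le_norm _).trans (norm_add_le_of_le hz hz'))
  · refine IsBigO.trans (IsBigO.of_bound 1 (Eventually.of_forall fun z => ?_)) hdrift
    rw [(hG z).fderiv, one_mul, smul_apply, ContinuousLinearMap.comp_apply, smul_eq_mul,
      ← div_eq_inv_mul, norm_div, Real.norm_two, Real.norm_eq_abs]
    exact (half_le_self (abs_nonneg _)).trans (Complex.abs_re_le_norm _)

end ComplexCoordinates

/-! ### Effective stability -/

section FirstCrossing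

theorem le_of_forall_lt_of_continuousOn {f : ℝ → ℝ} {a b c : ℝ} (hf : ContinuousOn f (Icc a b))
    (ha : f a ≤ c) (himprove : ∀ t ∈ Icc a b, (∀ τ ∈ Icc a t, f τ ≤ c) → f t < c) {t : ℝ}
    (ht : t ∈ Icc a b) : f t ≤ c := by
  by_contra! hct
  have hcompact : IsCompact (Icc a b ∩ f ⁻¹' Ici c) :=
    isCompact_Icc.of_isClosed_subset (hf.preimage_isClosed_of_isClosed isClosed_Icc isClosed_Ici)
      inter_subset_left
  obtain ⟨t₁, ⟨ht₁, hct₁⟩, hmin⟩ := hcompact.exists_isLeast ⟨t, ht, hct.le⟩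
  have hlt : ∀ τ ∈ Ico a t₁, f τ < c := fun τ hτ => by
    by_contra! hcτ
    exact hτ.2.not_ge (hmin ⟨⟨hτ.1, hτ.2.le.trans ht₁.2⟩, hcτ⟩)
  have hle : ∀ τ ∈ Icc a t₁, f τ ≤ c := by
    rcases ht₁.1.eq_or_lt with rfl | hat₁
    · simpa using ha
    · rw [← closure_Ico hat₁.ne]
      exact fun τ hτ => ContinuousWithinAt.closure_le hτ
        ((hf.mono (Icc_subset_Icc_right ht₁.2) τ (by rwa [← closure_Ico hat₁.ne])).mono
          Ico_subset_Icc_self) continuousWithinAt_const fun τ hτ => (hlt τ hτ).le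
  exact (himprove t₁ ht₁ hle).not_ge hct₁

end FirstCrossing

section Solutions

variable {E : Type*} [NormedAddCommGroup E] [NormedSpace ℝ E]

/-- `γ` is a curve on the time interval `s ∋ 0` that solves `γ' = X ∘ γ` whenever it lies in the
closed ball of radius `ρ`. Nothing is known about `γ` outside of this ball: this covers at once the
solutions of `X` and those of the modifications of `X` away from the origin. -/
structure IsSolutionInBall (X : E → E) (ρ : ℝ) (γ : ℝ → E) (s : Set ℝ) : Prop where
  ordConnected : s.OrdConnected
  zero_mem : 0 ∈ s
  continuousOn : ContinuousOn γ s
  hasDerivWithinAt : ∀ t ∈ s, ‖γ t‖ ≤ ρ → HasDerivWithinAt γ (X (γ t)) s t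

variable {X : E → E} {ρ : ℝ} {γ : ℝ → E} {s : Set ℝ}

theorem IsSolutionInBall.mono {s' : Set ℝ} (h : IsSolutionInBall X ρ γ s) (hs' : s'.OrdConnected)
    (h0 : 0 ∈ s') (hss' : s' ⊆ s) : IsSolutionInBall X ρ γ s' :=
  ⟨hs', h0, h.continuousOn.mono hss', fun t ht hγ => (h.hasDerivWithinAt t (hss' ht) hγ).mono hss'⟩

theorem IsSolutionInBall.Icc_of_mem (h : IsSolutionInBall X ρ γ s) {t : ℝ} (ht : t ∈ s)
    (ht0 : 0 ≤ t) : IsSolutionInBall X ρ γ (Icc 0 t) :=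
  h.mono ordConnected_Icc (left_mem_Icc.2 ht0) (h.ordConnected.out h.zero_mem ht)

theorem IsSolutionInBall.comp_neg (h : IsSolutionInBall X ρ γ s) :
    IsSolutionInBall (-X) ρ (fun t => γ (-t)) (-s) where
  ordConnected := h.ordConnected.preimage_anti fun _ _ => neg_le_neg
  zero_mem := by simpa using h.zero_mem
  continuousOn := h.continuousOn.comp continuousOn_neg fun _ ht => ht
  hasDerivWithinAt t ht hγ := by
    have hderiv := (h.hasDerivWithinAt (-t) ht hγ).scomp t (s := -s)
      (hasDerivAt_neg t).hasDerivWithinAt fun _ hτ => hτ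
    rwa [neg_one_smul] at hderiv

theorem isSolutionInBall_of_isIntegralCurveOn (h : IsIntegralCurveOn γ (fun _ => X) s)
    (hs : s.OrdConnected) (h0 : 0 ∈ s) : IsSolutionInBall X ρ γ s :=
  ⟨hs, h0, fun t ht => (h t ht).continuousWithinAt, fun t ht _ => h t ht⟩

theorem exists_isIntegralCurveOn_of_lipschitzWith [CompleteSpace E] {K : NNReal}
    (hX : LipschitzWith K X) {B : ℝ} (hB : ∀ x, ‖X x‖ ≤ B) (x : E) {T : ℝ} (hT : 0 ≤ T) :
    ∃ γ : ℝ → E, γ 0 = x ∧ IsIntegralCurveOn γ (fun _ => X) (Icc (-T) T) := by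
  lift B to NNReal using (norm_nonneg _).trans (hB x)
  lift T to NNReal using hT
  have hPL : IsPicardLindelof (fun _ => X) (tmin := -T) (tmax := T) ⟨0, by simp⟩ x (B * T) 0 B K :=
    { lipschitzOnWith := fun _ _ => hX.lipschitzOnWith
      continuousOn := fun _ _ => continuousOn_const
      norm_le := fun _ _ y _ => hB y
      mul_max_le := by simp [NNReal.coe_mul] }
  exact hPL.exists_eq_forall_mem_Icc_hasDerivWithinAt₀

theorem exists_lipschitzWith_eqOn_closedBall [FiniteDimensional ℝ E] {r R : ℝ} (hr : 0 < r)
    (hrR : r < R) (hX : ContDiffOn ℝ 1 X (Metric.ball 0 R)) :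
    ∃ (Y : E → E) (K : NNReal) (B : ℝ), LipschitzWith K Y ∧ (∀ x, ‖Y x‖ ≤ B) ∧
      EqOn Y X (Metric.closedBall 0 r) := by
  obtain ⟨r', hrr', hr'R⟩ := exists_between hrR
  let φ : ContDiffBump (0 : E) := ⟨r, r', hr, hrr'⟩
  have hsupp : HasCompactSupport fun x => φ x • X x := φ.hasCompactSupport.smul_right
  have hsmooth : ContDiff ℝ 1 fun x => φ x • X x := by
    refine (contMDiff_of_tsupport fun x hx => ContDiffAt.contMDiffAt ?_).contDiff
    have hxR : x ∈ Metric.ball (0 : E) R := by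
      have := tsupport_smul_subset_left φ X hx
      rw [φ.tsupport_eq] at this
      exact Metric.closedBall_subset_ball hr'R this
    exact φ.contDiff.contDiffAt.smul (hX.contDiffAt (Metric.isOpen_ball.mem_nhds hxR))
  obtain ⟨K, hK⟩ := hsmooth.lipschitzWith_of_hasCompactSupport hsupp (by simp)
  obtain ⟨B, hB⟩ := hsupp.exists_bound_of_continuous hsmooth.continuous
  refine ⟨_, K, B, hK, hB, fun x hx => ?_⟩
  simp only [φ.one_of_mem_closedBall hx, one_smul]

theorem exists_isIntegralCurveOn_of_forall_norm_le [FiniteDimensional ℝ E] {R T : ℝ} (hρ : 0 < ρ)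
    (hρR : ρ < R) (hX : ContDiffOn ℝ 1 X (Metric.ball 0 R)) (hT : 0 ≤ T) {x : E}
    (hbound : ∀ γ, γ 0 = x → IsSolutionInBall X ρ γ (Icc (-T) T) → ∀ t ∈ Icc (-T) T, ‖γ t‖ ≤ ρ) :
    ∃ γ : ℝ → E, γ 0 = x ∧ (∀ t ∈ Icc (-T) T, ‖γ t‖ ≤ ρ) ∧
      IsIntegralCurveOn γ (fun _ => X) (Icc (-T) T) := by
  obtain ⟨Y, K, B, hK, hB, hYX⟩ := exists_lipschitzWith_eqOn_closedBall hρ hρR hX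
  obtain ⟨γ, hγ0, hγ⟩ := exists_isIntegralCurveOn_of_lipschitzWith hK hB x hT
  have hderiv : ∀ t ∈ Icc (-T) T, ‖γ t‖ ≤ ρ →
      HasDerivWithinAt γ (X (γ t)) (Icc (-T) T) t := fun t ht hle => by
    rw [← hYX (mem_closedBall_zero_iff.2 hle)]
    exact hγ t ht
  have hle := hbound γ hγ0 ⟨ordConnected_Icc, ⟨by linarith, hT⟩,
    fun t ht => (hγ t ht).continuousWithinAt, hderiv⟩
  exact ⟨γ, hγ0, hle, fun t ht => hderiv t ht (hle t ht)⟩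

end Solutions

section ApproximateActions

variable {n : ℕ}

theorem sq_norm_eq_two_mul_sum_action (z : PhaseSpace n) : ‖z‖ ^ 2 = 2 * ∑ j, action j z := by
  rw [EuclideanSpace.norm_sq_eq, Fintype.sum_sum_type, ← Finset.sum_add_distrib, Finset.mul_sum]
  refine Finset.sum_congr rfl fun j _ => ?_
  simp only [action, Real.norm_eq_abs, sq_abs]
  ring

/-- The functions `G j` are approximate actions for the vector field `X` on the ball of radius `ρ`:
they are cubically close to the actions and drift along `X` at a rate at most `D * ‖z‖ ^ N`. -/
structure ApproximateActions (X : PhaseSpace n → PhaseSpace n) (G : Fin n → PhaseSpace n → ℝ)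
    (A D ρ : ℝ) (N : ℕ) : Prop where
  distance_nonneg : 0 ≤ A
  drift_nonneg : 0 ≤ D
  differentiable : ∀ j, Differentiable ℝ (G j)
  abs_sub_action_le : ∀ j z, ‖z‖ ≤ ρ → |G j z - action j z| ≤ A * ‖z‖ ^ 3
  abs_fderiv_le : ∀ j z, ‖z‖ ≤ ρ → |fderiv ℝ (G j) z (X z)| ≤ D * ‖z‖ ^ N

theorem exists_approximateActions {ω : Fin n → ℝ} (hω : NonResonant ω) {H : PhaseSpace n → ℝ}
    (hH : ContDiffAt ℝ (⊤ : ℕ∞) H 0)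
    (hH3 : (fun z => H z - harmonicOscillator ω z) =O[𝓝 0] fun z => ‖z‖ ^ 3) {ρ₀ : ℝ}
    (hρ₀ : 0 < ρ₀) :
    ∃ A > 0, ∀ N, ∃ (G : Fin n → PhaseSpace n → ℝ) (D ρ : ℝ), 0 < ρ ∧ ρ < ρ₀ ∧
      ApproximateActions (hamiltonianVectorField H) G A D ρ N := by
  choose A hA hG using exists_approximate_action hω hH hH3
  have hle {c : Fin n → ℝ} (hc : ∀ j, 0 < c j) (j : Fin n) : c j ≤ ∑ j, c j + 1 := by
    have := Finset.single_le_sum (fun j _ => (hc j).le) (Finset.mem_univ j)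
    linarith
  have hpos {c : Fin n → ℝ} (hc : ∀ j, 0 < c j) : 0 < ∑ j, c j + 1 := by
    have := Finset.sum_nonneg fun j (_ : j ∈ Finset.univ) => (hc j).le
    linarith
  refine ⟨∑ j, A j + 1, hpos hA, fun N => ?_⟩
  choose G hdiff hclose hdrift using fun j => hG j N
  choose D hD hdriftD using fun j => (hdrift j).exists_pos
  obtain ⟨R, hR, hball⟩ := Metric.nhds_basis_closedBall.eventually_iff.1
    (eventually_all.2 fun j => (hclose j).and (hdriftD j).bound)
  obtain ⟨ρ, hρ, hρlt⟩ := exists_between (lt_min hR hρ₀)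
  have hin (z : PhaseSpace n) (hz : ‖z‖ ≤ ρ) := hball
    (mem_closedBall_zero_iff.2 (hz.trans (hρlt.le.trans (min_le_left _ _))))
  refine ⟨G, ∑ j, D j + 1, ρ, hρ, hρlt.trans_le (min_le_right _ _), (hpos hA).le, (hpos hD).le,
    hdiff, fun j z hz => (hin z hz j).1.trans ?_, fun j z hz => (hin z hz j).2.trans ?_⟩
  · gcongr
    exact hle hA j
  · rw [norm_pow, norm_norm]
    gcongr
    exact hle hD j

namespace ApproximateActions

variable {X : PhaseSpace n → PhaseSpace n} {G : Fin n → PhaseSpace n → ℝ} {A D ρ : ℝ} {N : ℕ}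
  {γ : ℝ → PhaseSpace n} {s : Set ℝ} {ε t T : ℝ}

theorem neg (h : ApproximateActions X G A D ρ N) : ApproximateActions (-X) G A D ρ N :=
  { h with
    abs_fderiv_le := fun j z hz => by
      simpa only [Pi.neg_apply, map_neg, abs_neg] using h.abs_fderiv_le j z hz }

theorem abs_action_sub_le_of_norm_le (h : ApproximateActions X G A D ρ N) (hερ : 2 * ε ≤ ρ)
    (ht : 0 ≤ t) (hγ : IsSolutionInBall X ρ γ (Icc 0 t)) (h0 : ‖γ 0‖ ≤ ε)
    (hle : ∀ τ ∈ Icc 0 t, ‖γ τ‖ ≤ 2 * ε) (j : Fin n) :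
    |action j (γ t) - action j (γ 0)| ≤ D * (2 * ε) ^ N * t + 9 * A * ε ^ 3 := by
  have hA := h.distance_nonneg
  have hD := h.drift_nonneg
  have hdrift : |G j (γ t) - G j (γ 0)| ≤ D * (2 * ε) ^ N * t := by
    have hderiv (τ) (hτ : τ ∈ Icc 0 t) :=
      (h.differentiable j (γ τ)).hasFDerivAt.comp_hasDerivWithinAt τ
        (hγ.hasDerivWithinAt τ hτ ((hle τ hτ).trans hερ))
    have hbound (τ) (hτ : τ ∈ Ico 0 t) : ‖fderiv ℝ (G j) (γ τ) (X (γ τ))‖ ≤ D * (2 * ε) ^ N := by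
      have hτε := hle τ (Ico_subset_Icc_self hτ)
      exact (h.abs_fderiv_le j _ (hτε.trans hερ)).trans (by gcongr)
    simpa using norm_image_sub_le_of_norm_deriv_le_segment' hderiv hbound t (right_mem_Icc.2 ht)
  have hclose : |G j (γ t) - action j (γ t)| ≤ A * (2 * ε) ^ 3 := by
    have htε := hle t (right_mem_Icc.2 ht)
    exact (h.abs_sub_action_le j _ (htε.trans hερ)).trans (by gcongr)
  have hclose₀ : |G j (γ 0) - action j (γ 0)| ≤ A * ε ^ 3 :=
    (h.abs_sub_action_le j _ (by linarith [norm_nonneg (γ 0)])).trans (by gcongr)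
  rw [abs_le] at hdrift hclose hclose₀ ⊢
  constructor <;> linarith

theorem norm_lt_of_norm_le (h : ApproximateActions X G A D ρ N) (hε : 0 < ε) (hερ : 2 * ε ≤ ρ)
    (ht : 0 ≤ t) (hsmall : 2 * n * (D * (2 * ε) ^ N * t + 9 * A * ε ^ 3) < 3 * ε ^ 2)
    (hγ : IsSolutionInBall X ρ γ (Icc 0 t)) (h0 : ‖γ 0‖ ≤ ε)
    (hle : ∀ τ ∈ Icc 0 t, ‖γ τ‖ ≤ 2 * ε) : ‖γ t‖ < 2 * ε := by
  have hsum : ∑ j, (action j (γ t) - action j (γ 0)) ≤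
      n * (D * (2 * ε) ^ N * t + 9 * A * ε ^ 3) := by
    refine (Finset.sum_le_card_nsmul Finset.univ _ _ fun j _ => (le_abs_self _).trans
      (h.abs_action_sub_le_of_norm_le hερ ht hγ h0 hle j)).trans_eq ?_
    rw [Finset.card_univ, Fintype.card_fin, nsmul_eq_mul]
  rw [Finset.sum_sub_distrib] at hsum
  have h0sq : ‖γ 0‖ ^ 2 ≤ ε ^ 2 := by gcongr
  refine lt_of_pow_lt_pow_left₀ 2 (by positivity) ?_
  rw [sq_norm_eq_two_mul_sum_action] at h0sq ⊢
  linarith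

theorem norm_le_two_mul (h : ApproximateActions X G A D ρ N) (hε : 0 < ε) (hερ : 2 * ε ≤ ρ)
    (hsmall : 2 * n * (D * (2 * ε) ^ N * T + 9 * A * ε ^ 3) < 3 * ε ^ 2)
    (hγ : IsSolutionInBall X ρ γ (Icc 0 T)) (h0 : ‖γ 0‖ ≤ ε) (ht : t ∈ Icc 0 T) :
    ‖γ t‖ ≤ 2 * ε := by
  refine le_of_forall_lt_of_continuousOn hγ.continuousOn.norm (by linarith) (fun t ht hle => ?_) ht
  refine h.norm_lt_of_norm_le hε hερ ht.1 (lt_of_le_of_lt ?_ hsmall) (hγ.Icc_of_mem ht ht.1) h0 hle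
  have hD := h.drift_nonneg
  have htT := ht.2
  gcongr

theorem stability_of_nonneg (h : ApproximateActions X G A D ρ N) (hε : 0 < ε) (hερ : 2 * ε ≤ ρ)
    (hγ : IsSolutionInBall X ρ γ s) (h0 : ‖γ 0‖ ≤ ε) (ht : t ∈ s) (ht0 : 0 ≤ t)
    (hsmall : 2 * n * (D * (2 * ε) ^ N * t + 9 * A * ε ^ 3) < 3 * ε ^ 2) :
    ‖γ t‖ ≤ 2 * ε ∧
      ∀ j, |action j (γ t) - action j (γ 0)| ≤ D * (2 * ε) ^ N * t + 9 * A * ε ^ 3 := by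
  have hγt := hγ.Icc_of_mem ht ht0
  have hle (τ) (hτ : τ ∈ Icc 0 t) := h.norm_le_two_mul hε hερ hsmall hγt h0 hτ
  exact ⟨hle t (right_mem_Icc.2 ht0), h.abs_action_sub_le_of_norm_le hερ ht0 hγt h0 hle⟩

theorem stability (h : ApproximateActions X G A D ρ N) (hε : 0 < ε) (hερ : 2 * ε ≤ ρ)
    (hγ : IsSolutionInBall X ρ γ s) (h0 : ‖γ 0‖ ≤ ε) (ht : t ∈ s)
    (hsmall : 2 * n * (D * (2 * ε) ^ N * |t| + 9 * A * ε ^ 3) < 3 * ε ^ 2) :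
    ‖γ t‖ ≤ 2 * ε ∧
      ∀ j, |action j (γ t) - action j (γ 0)| ≤ D * (2 * ε) ^ N * |t| + 9 * A * ε ^ 3 := by
  rcases le_total 0 t with htp | htn
  · rw [abs_of_nonneg htp] at hsmall ⊢
    exact h.stability_of_nonneg hε hερ hγ h0 ht htp hsmall
  · rw [abs_of_nonpos htn] at hsmall ⊢
    simpa using h.neg.stability_of_nonneg hε hερ hγ.comp_neg (by simpa using h0)
      (by simpa using ht) (by simpa using htn) hsmall

theorem stability_long_time {m : ℕ} (h : ApproximateActions X G A D ρ (m + 3)) (hε : 0 < ε)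
    (hερ : 2 * ε ≤ ρ) (hsmall : 2 * n * (D * 2 ^ (m + 3) + 9 * A) * ε < 3)
    (hγ : IsSolutionInBall X ρ γ s) (h0 : ‖γ 0‖ ≤ ε) (ht : t ∈ s) (htime : ε ^ m * |t| ≤ 1) :
    ‖γ t‖ ≤ 2 * ε ∧ ∀ j, |action j (γ t) - action j (γ 0)| ≤
      (D * 2 ^ (m + 3) * (ε ^ m * |t|) + 9 * A) * ε ^ 3 := by
  have hD := h.drift_nonneg
  have hfactor : D * (2 * ε) ^ (m + 3) * |t| + 9 * A * ε ^ 3 =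
      (D * 2 ^ (m + 3) * (ε ^ m * |t|) + 9 * A) * ε ^ 3 := by ring
  rw [← hfactor]
  refine h.stability hε hερ hγ h0 ht ?_
  rw [hfactor]
  calc 2 * n * ((D * 2 ^ (m + 3) * (ε ^ m * |t|) + 9 * A) * ε ^ 3)
      ≤ 2 * n * ((D * 2 ^ (m + 3) * 1 + 9 * A) * ε ^ 3) := by gcongr
    _ = 2 * n * (D * 2 ^ (m + 3) + 9 * A) * ε * ε ^ 2 := by ring
    _ < 3 * ε ^ 2 := by gcongr

theorem exists_stability_of_pos {m : ℕ} (h : ApproximateActions X G A D ρ (m + 4)) (hρ : 0 < ρ) :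
    ∃ ε₀ > 0, 2 * ε₀ ≤ ρ ∧ ∀ ε γ s, 0 < ε → ε < ε₀ → IsSolutionInBall X ρ γ s → ‖γ 0‖ ≤ ε →
      ∀ t ∈ s, (ε ^ (m + 1) * |t| ≤ 1 → ‖γ t‖ ≤ 2 * ε) ∧
        (ε ^ m * |t| ≤ 1 → ∀ j, |action j (γ t) - action j (γ 0)| ≤ (9 * A + 1) * ε ^ 3) := by
  have hA := h.distance_nonneg
  obtain ⟨Q, hQdef⟩ : ∃ Q, Q = D * 2 ^ (m + 1 + 3) := ⟨_, rfl⟩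
  have hQ : 0 ≤ Q := hQdef ▸ mul_nonneg h.drift_nonneg (by positivity)
  have hW : 0 < 2 * n * (Q + 9 * A) + Q + 1 := by positivity
  refine ⟨min 1 (min (ρ / 2) (1 / (2 * n * (Q + 9 * A) + Q + 1))), by positivity, ?_,
    fun ε γ s hε hlt hγ h0 t ht => ?_⟩
  · linarith [min_le_left (ρ / 2) (1 / (2 * n * (Q + 9 * A) + Q + 1)),
      min_le_right 1 (min (ρ / 2) (1 / (2 * n * (Q + 9 * A) + Q + 1)))]
  rw [lt_min_iff, lt_min_iff, lt_div_iff₀' hW] at hlt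
  obtain ⟨hε1, hερ, hεW⟩ := hlt
  have hQε : 0 ≤ Q * ε := by positivity
  have hLε : 0 ≤ 2 * n * (Q + 9 * A) * ε := by positivity
  have hstab (htime : ε ^ (m + 1) * |t| ≤ 1) := h.stability_long_time (m := m + 1) hε (by linarith)
    (by rw [← hQdef]; linarith) hγ h0 ht htime
  rw [← hQdef] at hstab
  refine ⟨fun htime => (hstab htime).1, fun htime j => ?_⟩
  have htime_le : ε ^ (m + 1) * |t| ≤ ε := by
    rw [pow_succ', mul_assoc]
    exact mul_le_of_le_one_right hε.le htime
  have hdrift : Q * (ε ^ (m + 1) * |t|) ≤ Q * ε := by gcongr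
  refine ((hstab (htime_le.trans hε1.le)).2 j).trans (mul_le_mul_of_nonneg_right ?_ (by positivity))
  linarith

theorem exists_stability {m : ℕ} (h : ApproximateActions X G A D ρ (m + 4)) (hρ : 0 < ρ) :
    ∃ ε₀ > 0, 2 * ε₀ ≤ ρ ∧ ∀ γ s, ‖γ 0‖ < ε₀ → IsSolutionInBall X ρ γ s →
      ∀ t ∈ s, (‖γ 0‖ ^ (m + 1) * |t| ≤ 1 → ‖γ t‖ ≤ 2 * ‖γ 0‖) ∧
        (‖γ 0‖ ^ m * |t| ≤ 1 →
          ∀ j, |action j (γ t) - action j (γ 0)| ≤ (9 * A + 1) * ‖γ 0‖ ^ 3) := by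
  obtain ⟨ε₀, hε₀, hε₀ρ, hpos⟩ := h.exists_stability_of_pos hρ
  refine ⟨ε₀, hε₀, hε₀ρ, fun γ s h0 hγ t ht => ?_⟩
  rcases (norm_nonneg (γ 0)).eq_or_lt with hzero | hne
  · have hlim : Tendsto (fun δ : ℝ => 2 * δ) (𝓝[>] 0) (𝓝 0) := by
      simpa using ((continuous_const_mul (2 : ℝ)).tendsto 0).mono_left nhdsWithin_le_nhds
    have htime : Tendsto (fun δ : ℝ => δ ^ (m + 1) * |t|) (𝓝[>] 0) (𝓝 0) := by
      have hcont : Continuous fun δ : ℝ => δ ^ (m + 1) * |t| := by fun_prop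
      simpa using (hcont.tendsto 0).mono_left nhdsWithin_le_nhds
    have hγt : γ t = 0 := by
      refine norm_le_zero_iff.1 (ge_of_tendsto hlim ?_)
      filter_upwards [htime.eventually_le_const one_pos, Ioo_mem_nhdsGT hε₀] with δ hδt hδ
      exact (hpos δ γ s hδ.1 hδ.2 hγ (hzero.symm.trans_le hδ.1.le) t ht).1 hδt
    simp [norm_eq_zero.1 hzero.symm, hγt]
  · exact hpos _ γ s hne h0 hγ le_rfl t ht

end ApproximateActions

end ApproximateActions

section HamiltonianSystems

variable {n : ℕ} {M : Set (PhaseSpace n)} {H : PhaseSpace n → ℝ}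

theorem contDiff_harmonicOscillator (ω : Fin n → ℝ) {m : WithTop ℕ∞} :
    ContDiff ℝ m (harmonicOscillator ω) := by
  unfold harmonicOscillator action
  fun_prop

theorem isBigO_harmonicOscillator (ω : Fin n → ℝ) :
    harmonicOscillator ω =O[𝓝 0] fun z => ‖z‖ ^ 2 := by
  have hO := isBigO_evalForms (complexCoord (n := n))
    (oscillatorPoly_mem_ordIdeal fun j => (ω j : ℂ) / 2)
  refine IsBigO.of_norm_left (hO.norm_left.congr_left fun z => ?_)
  rw [evalForms_oscillatorPoly, Complex.norm_real]

theorem contDiffOn_hamiltonianVectorField (hM : IsOpen M) (hH : ContDiffOn ℝ 2 H M) :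
    ContDiffOn ℝ 1 (hamiltonianVectorField H) M := by
  have hd (v : PhaseSpace n) : ContDiffOn ℝ 1 (fun z => fderiv ℝ H z v) M :=
    (hH.fderiv_of_isOpen hM (by norm_num)).clm_apply contDiffOn_const
  refine contDiffOn_euclidean.2 fun i => ?_
  rcases i with j | j
  · exact hd _
  · exact (hd _).neg

theorem hamiltonianVectorField_zero_of_isBigO (hH : H =O[𝓝 0] fun z => ‖z‖ ^ 2) :
    hamiltonianVectorField H 0 = 0 := by
  have hderiv : fderiv ℝ H 0 = 0 :=
    (IsBigO.hasFDerivAt (by simpa using hH) (by norm_num)).fderiv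
  ext i
  rcases i with j | j <;> simp [hamiltonianVectorField, partialP, partialQ, hderiv]

theorem exists_isHamiltonianSolutionOn {ρ R : ℝ} {m : ℕ} (hM : Metric.ball 0 R ⊆ M) (hρ : 0 < ρ)
    (hρR : ρ < R) (hH : ContDiffOn ℝ 2 H (Metric.ball 0 R)) (hH0 : hamiltonianVectorField H 0 = 0)
    {z₀ : PhaseSpace n}
    (hbound : ∀ γ s, γ 0 = z₀ → IsSolutionInBall (hamiltonianVectorField H) ρ γ s →
      ∀ t ∈ s, ‖z₀‖ ^ m * |t| ≤ 1 → ‖γ t‖ ≤ ρ) :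
    ∃ γ : ℝ → PhaseSpace n, γ 0 = z₀ ∧
      IsHamiltonianSolutionOn M H γ {t | ‖z₀‖ ^ m * |t| ≤ 1} := by
  rcases eq_or_ne z₀ 0 with rfl | hz₀
  · refine ⟨fun _ => 0, rfl, fun _ _ => hM (Metric.mem_ball_self (hρ.trans hρR)), fun t _ => ?_⟩
    simpa only [hH0] using hasDerivWithinAt_const t _ (0 : PhaseSpace n)
  · have hpos : 0 < ‖z₀‖ ^ m := pow_pos (norm_pos_iff.2 hz₀) m
    have htime : {t : ℝ | ‖z₀‖ ^ m * |t| ≤ 1} = Icc (-(‖z₀‖ ^ m)⁻¹) (‖z₀‖ ^ m)⁻¹ := by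
      ext t
      rw [mem_ofPred_eq, mem_Icc, ← abs_le, ← one_div, le_div_iff₀' hpos]
    obtain ⟨γ, hγ0, hle, hγ⟩ := exists_isIntegralCurveOn_of_forall_norm_le hρ hρR
      (contDiffOn_hamiltonianVectorField Metric.isOpen_ball hH) (inv_nonneg.2 hpos.le)
      (x := z₀) fun γ hγ0 hγ t ht => hbound γ _ hγ0 hγ t ht (htime.ge ht)
    rw [htime]
    exact ⟨γ, hγ0, fun t ht => hM (mem_ball_zero_iff.2 ((hle t ht).trans_lt hρR)), hγ⟩

end HamiltonianSystems

end BirkhoffNormalForm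

end

open BirkhoffNormalForm in
theorem mainTheorem7_general {n : ℕ} {ω : Fin n → ℝ} (hω : NonResonant ω)
    {M : Set (PhaseSpace n)} (hM : M ∈ 𝓝 0) {P : PhaseSpace n → ℝ}
    (hP : ContDiffAt ℝ (⊤ : ℕ∞) P 0) (hP3 : P =O[𝓝 (0 : PhaseSpace n)] fun z => ‖z‖ ^ 3) :
    ∃ K : ℝ, 0 < K ∧ ∀ r : ℕ, 2 ≤ r →
      ∃ ε₀ : ℝ, 0 < ε₀ ∧ ∃ C : ℝ, 0 < C ∧
        ∀ (z₀ : PhaseSpace n) (ε : ℝ), ‖z₀‖ = ε → ε < ε₀ →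
          (∃ γ : ℝ → PhaseSpace n, γ 0 = z₀ ∧
            IsHamiltonianSolutionOn M (fun z => harmonicOscillator ω z + P z) γ
              {t : ℝ | ε ^ (r - 1) * |t| ≤ C}) ∧
          ∀ (s : Set ℝ) (γ : ℝ → PhaseSpace n), s.OrdConnected → 0 ∈ s → γ 0 = z₀ →
            IsHamiltonianSolutionOn M (fun z => harmonicOscillator ω z + P z) γ s →
            (∀ t ∈ s, ε ^ (r - 1) * |t| ≤ C → ‖γ t‖ ≤ 2 * ε) ∧
            (∀ t ∈ s, ε ^ (r - 2) * |t| ≤ C →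
              ∀ j : Fin n, |action j (γ t) - action j (γ 0)| ≤ K * ε ^ 3) := by
  have hH : ContDiffAt ℝ (⊤ : ℕ∞) (fun z => harmonicOscillator ω z + P z) 0 :=
    (contDiff_harmonicOscillator ω).contDiffAt.add hP
  have hH0 := hamiltonianVectorField_zero_of_isBigO
    ((isBigO_harmonicOscillator ω).add (isBigO_norm_pow_mono (by norm_num) hP3))
  obtain ⟨R, hR, hball⟩ := Metric.eventually_nhds_iff_ball.1
    (((hH.of_le (WithTop.coe_le_coe.2 le_top)).eventually (n := 2) (by simp)).and hM)
  obtain ⟨A, hA, hint⟩ := exists_approximateActions hω hH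
    (by simpa only [add_sub_cancel_left] using hP3) hR
  refine ⟨9 * A + 1, by positivity, fun r hr => ?_⟩
  obtain ⟨m, rfl⟩ := Nat.exists_eq_add_of_le' hr
  obtain ⟨G, D, ρ, hρ, hρR, hG⟩ := hint (m + 4)
  obtain ⟨ε₀, hε₀, hε₀ρ, hstab⟩ := hG.exists_stability hρ
  refine ⟨ε₀, hε₀, 1, one_pos, fun z₀ ε hε hlt => ⟨?_, fun s γ hs h0s hγ0 hγ => ?_⟩⟩
  · subst hε
    refine exists_isHamiltonianSolutionOn (fun z hz => (hball z hz).2) hρ hρR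
      (fun z hz => (hball z hz).1.contDiffWithinAt) hH0 fun γ s hγ0 hγ t ht htime => ?_
    subst hγ0
    linarith [(hstab γ s hlt hγ t ht).1 htime]
  · subst hε hγ0
    have hbounds := hstab γ s hlt (isSolutionInBall_of_isIntegralCurveOn hγ.2 hs h0s)
    exact ⟨fun t ht => (hbounds t ht).1, fun t ht => (hbounds t ht).2⟩

theorem mainTheorem7 {n : ℕ} (ω : Fin n → ℝ) (hω : NonResonant ω)
    (M : Set (PhaseSpace n)) (hM : IsOpen M) (h0 : (0 : PhaseSpace n) ∈ M)
    (P : PhaseSpace n → ℝ) (hP : ContDiffOn ℝ (⊤ : ℕ∞) P M)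
    (hP3 : P =O[𝓝 (0 : PhaseSpace n)] fun z => ‖z‖ ^ 3) :
    ∃ K : ℝ, 0 < K ∧ ∀ r : ℕ, 3 ≤ r →
      ∃ ε₀ : ℝ, 0 < ε₀ ∧ ∃ C : ℝ, 0 < C ∧
        ∀ (z₀ : PhaseSpace n) (ε : ℝ), ‖z₀‖ = ε → ε < ε₀ →
          -- the solution exists in `M` for `|t| ≤ C / ε ^ (r - 1)` (for all `t` when `ε = 0`)
          (∃ γ : ℝ → PhaseSpace n, γ 0 = z₀ ∧
            IsHamiltonianSolutionOn M (fun z => harmonicOscillator ω z + P z) γ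
              {t : ℝ | ε ^ (r - 1) * |t| ≤ C}) ∧
          -- and every solution, on any interval around the time `0`, satisfies the two bounds
          ∀ (s : Set ℝ) (γ : ℝ → PhaseSpace n), s.OrdConnected → 0 ∈ s → γ 0 = z₀ →
            IsHamiltonianSolutionOn M (fun z => harmonicOscillator ω z + P z) γ s →
            (∀ t ∈ s, ε ^ (r - 1) * |t| ≤ C → ‖γ t‖ ≤ 2 * ε) ∧
            (∀ t ∈ s, ε ^ (r - 2) * |t| ≤ C →
              ∀ j : Fin n, |action j (γ t) - action j (γ 0)| ≤ K * ε ^ 3) := by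
  obtain ⟨K, hK, hstab⟩ := mainTheorem7_general hω (hM.mem_nhds h0)
    (hP.contDiffAt (hM.mem_nhds h0)) hP3
  exact ⟨K, hK, fun r hr => hstab r (by omega)⟩
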